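/- Let $Y$ be an $n$-dimensional toric Fano manifold, given by a smooth complete fan in a lattice $N\cong\mathbb{Z}^n$ with ray generators $v_1,\dots,v_R$, and let $D_j\in\operatorname{Pic}(Y)$ be the class of the torus-invariant prime divisor of the $j$-th ray. Let $L_1,\dots,L_c\in\operatorname{Pic}(Y)$ be nef classes such that $-K_Y-L_1-\cdots-L_c$ is ample, and let $X\subset Y$ be a complete intersection defined by sections of $L_1,\dots,L_c$. A *nef partition* of $(Y;L_1,\dots,L_c)$ is a partition of $\{1,\dots,R\}$ into sets $S_1,\dots,S_{c+1}$ with $L_i=\sum_{j\in S_i}D_j$ for $1\le i\le c$. Given a nef partition, choose elements $s_i\in S_i$ for $1\le i\le c$ and a subset $E\subset S_{c+1}$ such that $\{D_b: b\in E\}$ is a basis of $\operatorname{Pic}(Y)$ and every $L_i$ is a non-negative linear combination of $\{D_b: b\in E\}$. The *Przyjalkowski method* associates to these choices the following Laurent polynomial $f$ in the variables $y_j$, $j\notin E\cup\{s_1,\dots,s_c\}$, called a Laurent polynomial mirror to $X$. Put $y_{s_i}=1$ for $1\le i\le c$. Set $x_j=y_j/\sum_{k\in S_i}y_k$ for $j\in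 S_i$, $1\le i\le c$; set $x_j=y_j$ for $j\in S_{c+1}\setminus E$; and let $x_b$, $b\in E$, be the rational functions determined by requiring $\prod_{j=1}^R x_j^{l_j}=1$ for all $l\in\mathbb{Z}^R$ with $\sum_j l_jv_j=0$. Then $f=x_1+\cdots+x_R$. Laurent polynomials $f$ and $g$ on tori with coordinates $z_1,\dots,z_m$ and $z_1',\dots,z_m'$ are *mutation equivalent* if there is a birational map $\varphi$ from the torus of $g$ to the torus of $f$ with $\varphi^\star f=g$ that is volume preserving, i.e. $\varphi^\star\big(\bigwedge_i d\log z_i\big)=\pm\bigwedge_i d\log z'_i$ (the form of a torus depends on the order of its coordinates and so is defined up to sign). **Corollary.** Let $f$ and $g$ be Laurent polynomial mirrors to $X$ obtained by the Przyjalkowski method from two nef partitions of the same $(Y;L_1,\dots,L_c)$, each with its own choice of elements $s_i\in S_i$ and subset $E\subset S_{c+1}$ as above. Then $f$ and $g$ are mutation equivalent. -/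

import Mathlib

noncomputable section

/-! ### Toric manifolds, their Picard groups, nef and ample classes -/

/-- A smooth complete fan in `N = ℤⁿ` with `R` rays, i.e. a smooth complete toric variety `Y` of
dimension `n`.  The `j`-th ray is generated by `ray j`, and a maximal cone is recorded by the set of
its rays. -/
structure SmoothCompleteFan (n R : ℕ) where
  /-- the ray generators `v_1, …, v_R` -/
  ray : Fin R → (Fin n → ℤ)
  /-- the maximal cones -/
  maxCones : Set (Finset (Fin R))
  /-- every ray belongs to the fan -/
  exists_mem : ∀ j, ∃ σ ∈ maxCones, j ∈ σ
  /-- smoothness: the rays of a maximal cone form a `ℤ`-basis of `N` -/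
  linearIndependent : ∀ σ ∈ maxCones, LinearIndependent ℤ (fun j : σ => ray j)
  span_eq_top : ∀ σ ∈ maxCones, Submodule.span ℤ (Set.range fun j : σ => ray j) = ⊤
  /-- two maximal cones meet in the common face spanned by their common rays -/
  inter_eq : ∀ σ ∈ maxCones, ∀ τ ∈ maxCones,
    (PointedCone.hull ℝ ((fun j k => (ray j k : ℝ)) '' (σ : Set (Fin R))) : Set (Fin n → ℝ)) ∩
      PointedCone.hull ℝ ((fun j k => (ray j k : ℝ)) '' (τ : Set (Fin R))) =
    PointedCone.hull ℝ ((fun j k => (ray j k : ℝ)) '' ((σ : Set (Fin R)) ∩ τ))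
  /-- completeness: the cones cover `N ⊗ ℝ` -/
  complete : ∀ x : Fin n → ℝ, ∃ σ ∈ maxCones,
    x ∈ PointedCone.hull ℝ ((fun j k => (ray j k : ℝ)) '' (σ : Set (Fin R)))

namespace SmoothCompleteFan

variable {n R : ℕ} (Y : SmoothCompleteFan n R)

/-- The map `ρ^⋆ : M → (ℤ^R)^⋆`, `m ↦ (⟨m, v_j⟩)_j`, where `M` is the dual lattice of `N`. -/
def rhoDual : Module.Dual ℤ (Fin n → ℤ) →ₗ[ℤ] (Fin R → ℤ) :=
  LinearMap.pi fun j => Module.Dual.eval ℤ (Fin n → ℤ) (Y.ray j)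

/-- `Pic(Y)`, the cokernel of `ρ^⋆`: torus-invariant divisors modulo divisors of characters. -/
abbrev Pic : Type := (Fin R → ℤ) ⧸ LinearMap.range Y.rhoDual

/-- The class of the torus-invariant divisor with coefficients `a`. -/
def divClass : (Fin R → ℤ) →ₗ[ℤ] Y.Pic := (LinearMap.range Y.rhoDual).mkQ

/-- The class `D_j` of the torus-invariant prime divisor of the `j`-th ray. -/
def D (j : Fin R) : Y.Pic := Y.divClass (Pi.single j 1)

/-- The anticanonical class `-K_Y`. -/
def antiK : Y.Pic := ∑ j, Y.D j

/-- A class is nef if the support function of a torus-invariant divisor `∑ a_j D_j` representing it,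
given by `m` on the maximal cone `σ`, is convex. -/
def IsNef (L : Y.Pic) : Prop :=
  ∃ a : Fin R → ℤ, Y.divClass a = L ∧ ∀ σ ∈ Y.maxCones, ∃ m : Module.Dual ℤ (Fin n → ℤ),
    (∀ j ∈ σ, m (Y.ray j) = -a j) ∧ ∀ j, -a j ≤ m (Y.ray j)

/-- A class is ample if the support function of a torus-invariant divisor `∑ a_j D_j` representing
it, given by `m` on the maximal cone `σ`, is strictly convex. -/
def IsAmple (L : Y.Pic) : Prop :=
  ∃ a : Fin R → ℤ, Y.divClass a = L ∧ ∀ σ ∈ Y.maxCones, ∃ m : Module.Dual ℤ (Fin n → ℤ),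
    (∀ j ∈ σ, m (Y.ray j) = -a j) ∧ ∀ j ∉ σ, -a j < m (Y.ray j)

end SmoothCompleteFan

/-! ### Laurent polynomials, rational functions, mutation equivalence -/

/-- The ring of complex Laurent polynomials in variables indexed by `J`, that is, the coordinate
ring of the torus `(ℂ^⋆)^J`. -/
abbrev LaurentRing (J : Type) : Type := AddMonoidAlgebra ℂ (J →₀ ℤ)

/-- The field of rational functions on the torus `(ℂ^⋆)^J`. -/
abbrev TorusFunctionField (J : Type) : Type := FractionRing (LaurentRing J)

/-- The `j`-th coordinate of the torus, as a rational function. -/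
def torusCoord {J : Type} (j : J) : TorusFunctionField J :=
  algebraMap (LaurentRing J) (TorusFunctionField J)
    (AddMonoidAlgebra.single (Finsupp.single j 1) 1)

/-- The logarithmic form `d log x_1 ∧ ⋯ ∧ d log x_m` of rational functions on a torus. -/
def logForm {J : Type} {m : ℕ} (x : Fin m → TorusFunctionField J) :
    ⋀[TorusFunctionField J]^m (Ω[TorusFunctionField J⁄ℂ]) :=
  exteriorPower.ιMulti (TorusFunctionField J) m
    fun i => (x i)⁻¹ • KaehlerDifferential.D ℂ (TorusFunctionField J) (x i)

/-- A birational map `(ℂ^⋆)^{J'} ⇢ (ℂ^⋆)^J`, given by its pull-back `φ` of rational functions, is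
volume preserving if the pull-back of `∧ d log z_j`, which is `∧ d log (φ z_j)`, is
`∧ d log z'_j`.  The form of a torus depends on the order of the coordinates, so it is defined up
to sign only, and the equality is up to sign. -/
def IsVolumePreserving {J J' : Type}
    (φ : TorusFunctionField J ≃ₐ[ℂ] TorusFunctionField J') : Prop :=
  ∃ (m : ℕ) (e : Fin m ≃ J) (e' : Fin m ≃ J'),
    logForm (fun i => φ (torusCoord (e i))) = logForm (fun i => torusCoord (e' i)) ∨
    logForm (fun i => φ (torusCoord (e i))) = -logForm (fun i => torusCoord (e' i))

/-- Laurent polynomials `f` and `g` are mutation equivalent if `φ^⋆ f = g` for a volume preserving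
birational map `φ` of tori; birational maps are isomorphisms of function fields over `ℂ`. -/
def MutationEquivalent {J J' : Type} (f : LaurentRing J) (g : LaurentRing J') : Prop :=
  ∃ φ : TorusFunctionField J ≃ₐ[ℂ] TorusFunctionField J',
    IsVolumePreserving φ ∧
    φ (algebraMap (LaurentRing J) (TorusFunctionField J) f) =
      algebraMap (LaurentRing J') (TorusFunctionField J') g

/-! ### Nef partitions and the Przyjalkowski method -/

/-- A nef partition of `(Y; L_1, …, L_c)`: a partition of the rays into `c + 1` sets such that
`L_i = ∑_{j ∈ S_i} D_j` for the first `c` of them. -/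
structure NefPartition {n R c : ℕ} (Y : SmoothCompleteFan n R) (L : Fin c → Y.Pic) where
  S : Fin (c + 1) → Finset (Fin R)
  existsUnique_mem : ∀ j, ∃! i, j ∈ S i
  sum_eq : ∀ i : Fin c, ∑ j ∈ S i.castSucc, Y.D j = L i

/-- The choices of the Przyjalkowski method for a nef partition: elements `s_i ∈ S_i` for `i ≤ c`,
and a subset `E` of `S_{c+1}` whose divisors form a basis of `Pic(Y)` in which every `L_i` has
non-negative coefficients. -/
structure PrzyjalkowskiChoice {n R c : ℕ} {Y : SmoothCompleteFan n R} {L : Fin c → Y.Pic}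
    (P : NefPartition Y L) where
  s : Fin c → Fin R
  s_mem : ∀ i, s i ∈ P.S i.castSucc
  E : Finset (Fin R)
  E_subset : E ⊆ P.S (Fin.last c)
  linearIndependent : LinearIndependent ℤ (fun b : E => Y.D b)
  span_eq_top : Submodule.span ℤ (Set.range fun b : E => Y.D b) = ⊤
  nonneg : ∀ i, ∃ a : Fin R → ℕ, L i = ∑ b ∈ E, a b • Y.D b

namespace PrzyjalkowskiChoice

variable {n R c : ℕ} {Y : SmoothCompleteFan n R} {L : Fin c → Y.Pic} {P : NefPartition Y L}
  (d : PrzyjalkowskiChoice P)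

/-- The index set of the variables of the Laurent polynomial: all rays except the `s_i` and those
of `E`. -/
abbrev Var : Type := {j : Fin R // j ∉ d.E ∧ ∀ i, j ≠ d.s i}

/-- The variable `y_j` of a ray `j ∉ E`, where `y_j = 1` for `j = s_i`
(the value at `j ∈ E` is never used). -/
def y (j : Fin R) : TorusFunctionField d.Var :=
  open Classical in if h : j ∉ d.E ∧ ∀ i, j ≠ d.s i then torusCoord (J := d.Var) ⟨j, h⟩ else 1

/-- The substitution of the Przyjalkowski method.  The torus `Spec ℂ[N]`, on which the potential
`W = z^{v_1} + ⋯ + z^{v_R}` lives, has coordinates `x_j = z^{v_j}` subject to the monomial relations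
given by the linear relations among the `v_j`.  The equations `∑_{j ∈ S_i} x_j = 1` are solved by
`x_j = y_j / ∑_{k ∈ S_i} y_k`; the `x_j` with `j ∈ S_{c+1} \ E` are free variables; and the `x_b`
with `b ∈ E` are eliminated by means of the relations. -/
structure IsSubstitution (x : Fin R → TorusFunctionField d.Var) : Prop where
  ne_zero : ∀ j, x j ≠ 0
  relation : ∀ l : Fin R → ℤ, ∑ j, l j • Y.ray j = 0 → ∏ j, x j ^ l j = 1
  block : ∀ i : Fin c, ∀ j ∈ P.S i.castSucc, x j = d.y j / ∑ k ∈ P.S i.castSucc, d.y k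
  free : ∀ j ∈ P.S (Fin.last c), j ∉ d.E → x j = d.y j

/-- `f` is the Laurent polynomial formed by the Przyjalkowski method: as a rational function on its
torus it is the potential `W = x_1 + ⋯ + x_R` after the substitution. -/
def IsMirror (f : LaurentRing d.Var) : Prop :=
  ∃ x, d.IsSubstitution x ∧
    algebraMap (LaurentRing d.Var) (TorusFunctionField d.Var) f = ∑ j, x j

/-! The next facts check that the Przyjalkowski method produces a Laurent polynomial. -/

theorem y_zpow_mem (j : Fin R) (z : ℤ) :
    d.y j ^ z ∈ (algebraMap (LaurentRing d.Var) (TorusFunctionField d.Var)).range := by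
  unfold y
  split_ifs with h
  · set J := d.Var
    have hinv : (torusCoord (J := J) ⟨j, h⟩)⁻¹ =
        algebraMap (LaurentRing J) (TorusFunctionField J)
          (AddMonoidAlgebra.single (Finsupp.single ⟨j, h⟩ (-1)) 1) := by
      refine inv_eq_of_mul_eq_one_right ?_
      rw [torusCoord, ← map_mul, AddMonoidAlgebra.single_mul_single, ← Finsupp.single_add]
      simp [← AddMonoidAlgebra.one_def]
    obtain ⟨k, rfl | rfl⟩ := z.eq_nat_or_neg
    · rw [zpow_natCast]
      exact pow_mem (RingHom.mem_range_self _ _) k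
    · rw [zpow_neg, zpow_natCast, ← inv_pow, hinv]
      exact pow_mem (RingHom.mem_range_self _ _) k
  · rw [one_zpow]
    exact one_mem _

theorem y_ne_zero (j : Fin R) : d.y j ≠ 0 := by
  unfold y
  split_ifs with h
  · rw [torusCoord]
    refine (map_ne_zero_iff _ (IsFractionRing.injective _ _)).2 ?_
    simp [AddMonoidAlgebra.single_eq_zero]
  · exact one_ne_zero

theorem sum_y_ne_zero (T : Finset (Fin R)) (hT : T.Nonempty) : ∑ k ∈ T, d.y k ≠ 0 := by
  classical
  set J := d.Var
  let y' : Fin R → LaurentRing J := fun j =>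
    if h : j ∉ d.E ∧ ∀ i, j ≠ d.s i then AddMonoidAlgebra.single (Finsupp.single ⟨j, h⟩ 1) 1 else 1
  have hy : ∀ j, d.y j = algebraMap (LaurentRing J) (TorusFunctionField J) (y' j) := by
    intro j
    simp only [y, y']
    split_ifs
    · rfl
    · simp
  let ε : LaurentRing J →ₐ[ℂ] ℂ := AddMonoidAlgebra.lift ℂ ℂ (J →₀ ℤ) 1
  have hε : ∀ j, ε (y' j) = 1 := by
    intro j
    simp only [y', ε]
    split_ifs
    · simp
    · simp
  simp_rw [hy]
  rw [← map_sum]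
  refine (map_ne_zero_iff _ (IsFractionRing.injective _ _)).2 ?_
  intro h0
  have h1 := congrArg ε h0
  simp only [map_sum, hε, map_zero, Finset.sum_const, nsmul_eq_mul, mul_one, Nat.cast_eq_zero,
    Finset.card_eq_zero] at h1
  exact hT.ne_empty h1

theorem exists_isMirror : ∃ f, d.IsMirror f := by
  classical
  set K := TorusFunctionField d.Var
  set A := (algebraMap (LaurentRing d.Var) (TorusFunctionField d.Var)).range
  let B : Module.Basis d.E ℤ Y.Pic := Module.Basis.mk d.linearIndependent d.span_eq_top.ge
  let q : Fin R → Fin R → ℤ := fun k b => if h : b ∈ d.E then B.repr (Y.D k) ⟨b, h⟩ else 0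
  choose blk hblk using fun j => (P.existsUnique_mem j).exists
  have hblk' : ∀ j i, j ∈ P.S i ↔ blk j = i := fun j i =>
    ⟨fun h => (P.existsUnique_mem j).unique (hblk j) h, fun h => h ▸ hblk j⟩
  let den : Fin (c + 1) → K :=
    Fin.lastCases 1 (fun i => ∑ k ∈ P.S i.castSucc, d.y k)
  have hdenl : den (Fin.last c) = 1 := by simp [den]
  have hdenc : ∀ i : Fin c, den i.castSucc = ∑ k ∈ P.S i.castSucc, d.y k := by
    intro i; simp [den]
  have hden0 : ∀ i, den i ≠ 0 := by
    intro i
    induction i using Fin.lastCases with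
    | last => rw [hdenl]; exact one_ne_zero
    | cast i => rw [hdenc]; exact d.sum_y_ne_zero _ ⟨_, d.s_mem i⟩
  let x0 : Fin R → K := fun j => d.y j / den (blk j)
  have hx0 : ∀ j, x0 j ≠ 0 := fun j => div_ne_zero (d.y_ne_zero j) (hden0 _)
  let x : Fin R → K := fun j =>
    if j ∈ d.E then ∏ k ∈ d.Eᶜ, x0 k ^ (-q k j) else x0 j
  have hxE : ∀ j ∈ d.E, x j = ∏ k ∈ d.Eᶜ, x0 k ^ (-q k j) := fun j hj => if_pos hj
  have hxn : ∀ j ∉ d.E, x j = x0 j := fun j hj => if_neg hj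
  have hEl : ∀ b ∈ d.E, blk b = Fin.last c := fun b hb => (hblk' _ _).1 (d.E_subset hb)
  have hSE : ∀ (i : Fin c), ∀ j ∈ P.S i.castSucc, j ∉ d.E := by
    intro i j hj hE
    have := hEl j hE
    rw [(hblk' _ _).1 hj] at this
    exact (Fin.castSucc_lt_last i).ne this
  have hblock : ∀ i : Fin c, ∀ j ∈ P.S i.castSucc,
      x j = d.y j / ∑ k ∈ P.S i.castSucc, d.y k := by
    intro i j hj
    rw [hxn j (hSE i j hj), ← hdenc, ← (hblk' _ _).1 hj]
  have hfree : ∀ j ∈ P.S (Fin.last c), j ∉ d.E → x j = d.y j := by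
    intro j hj hE
    simp only [hxn j hE, x0, (hblk' _ _).1 hj, hdenl, div_one]
  have hrepr : ∀ (v : Y.Pic) (μ : Y.Pic →ₗ[ℤ] ℤ),
      μ v = ∑ b : d.E, B.repr v b * μ (Y.D b) := by
    intro v μ
    conv_lhs => rw [← B.sum_repr v]
    simp [B]
  have hrel : ∀ l : Fin R → ℤ, ∑ j, l j • Y.ray j = 0 →
      ∀ k, l k = ∑ b ∈ d.E, q k b * l b := by
    intro l hl k
    let μ0 : (Fin R → ℤ) →ₗ[ℤ] ℤ := ∑ j, l j • LinearMap.proj j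
    have hμ0 : LinearMap.range Y.rhoDual ≤ LinearMap.ker μ0 := by
      rintro _ ⟨m, rfl⟩
      have h2 := congrArg m hl
      simp only [map_sum, map_smul, map_zero] at h2
      simpa [μ0, SmoothCompleteFan.rhoDual] using h2
    let μ : Y.Pic →ₗ[ℤ] ℤ := (LinearMap.range Y.rhoDual).liftQ μ0 hμ0
    have hμ : ∀ j, μ (Y.D j) = l j := by
      intro j
      have : μ (Y.D j) = μ0 (Pi.single j 1) := rfl
      rw [this]
      simp [μ0, Pi.single_apply]
    rw [← hμ k, hrepr, ← Finset.sum_coe_sort d.E]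
    refine Finset.sum_congr rfl fun b _ => ?_
    simp [q, hμ]
  have hrelx : ∀ l : Fin R → ℤ, ∑ j, l j • Y.ray j = 0 → ∏ j, x j ^ l j = 1 := by
    intro l hl
    rw [← Finset.prod_mul_prod_compl d.E]
    have h1 : ∏ j ∈ d.E, x j ^ l j = ∏ k ∈ d.Eᶜ, x0 k ^ (-l k) := by
      calc ∏ j ∈ d.E, x j ^ l j = ∏ j ∈ d.E, ∏ k ∈ d.Eᶜ, x0 k ^ (-q k j * l j) := by
            refine Finset.prod_congr rfl fun j hj => ?_
            rw [hxE j hj, ← Finset.prod_zpow]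
            simp_rw [zpow_mul]
        _ = ∏ k ∈ d.Eᶜ, ∏ j ∈ d.E, x0 k ^ (-q k j * l j) := Finset.prod_comm
        _ = _ := by
            refine Finset.prod_congr rfl fun k _ => ?_
            rw [hrel l hl k, ← Finset.sum_neg_distrib]
            have : ∀ T : Finset (Fin R), ∏ j ∈ T, x0 k ^ (-q k j * l j) =
                x0 k ^ ∑ j ∈ T, -(q k j * l j) := by
              intro T
              induction T using Finset.induction_on with
              | empty => simp
              | insert a T ha ih =>
                rw [Finset.prod_insert ha, Finset.sum_insert ha, zpow_add₀ (hx0 k), ih, neg_mul]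
            exact this _
    have h2 : ∏ k ∈ d.Eᶜ, x k ^ l k = ∏ k ∈ d.Eᶜ, x0 k ^ l k :=
      Finset.prod_congr rfl fun k hk => by rw [hxn k (Finset.mem_compl.1 hk)]
    rw [h1, h2, ← Finset.prod_mul_distrib]
    refine Finset.prod_eq_one fun k _ => ?_
    rw [← zpow_add₀ (hx0 k), neg_add_cancel, zpow_zero]
  have hne : ∀ j, x j ≠ 0 := by
    intro j
    by_cases hj : j ∈ d.E
    · rw [hxE j hj]
      exact Finset.prod_ne_zero_iff.2 fun k _ => zpow_ne_zero _ (hx0 k)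
    · rw [hxn j hj]
      exact hx0 j
  have hyA : ∀ j, d.y j ∈ A := fun j => zpow_one (d.y j) ▸ d.y_zpow_mem j 1
  have hfib : ∀ i, Finset.univ.filter (fun j => blk j = i) = P.S i := by
    intro i; ext j; simp [hblk']
  have hEA : ∀ b ∈ d.E, x b ∈ A := by
    intro b hb
    have hcalc : x b = (∏ k ∈ d.Eᶜ, d.y k ^ (-q k b)) * ∏ k ∈ d.Eᶜ, den (blk k) ^ q k b := by
      rw [hxE b hb, ← Finset.prod_mul_distrib]
      refine Finset.prod_congr rfl fun k _ => ?_
      simp only [x0]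
      rw [div_zpow, zpow_neg (den (blk k)), div_inv_eq_mul]
    rw [hcalc]
    refine mul_mem (prod_mem fun k _ => d.y_zpow_mem k _) ?_
    rw [← Finset.prod_fiberwise (d.Eᶜ) blk]
    refine prod_mem fun i _ => ?_
    have h1 : ∏ k ∈ d.Eᶜ with blk k = i, den (blk k) ^ q k b =
        ∏ k ∈ d.Eᶜ with blk k = i, den i ^ q k b :=
      Finset.prod_congr rfl fun k hk => by rw [(Finset.mem_filter.1 hk).2]
    rw [h1]
    induction i using Fin.lastCases with
    | last =>
      simp only [hdenl, one_zpow, Finset.prod_const_one]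
      exact one_mem _
    | cast i =>
      have h2 : (d.Eᶜ).filter (fun k => blk k = i.castSucc) = P.S i.castSucc := by
        ext k
        simp only [Finset.mem_filter, Finset.mem_compl, hblk']
        exact ⟨fun h => h.2, fun h => ⟨hSE i k ((hblk' _ _).2 h), h⟩⟩
      rw [h2]
      have h3 : ∀ T : Finset (Fin R), ∏ k ∈ T, den i.castSucc ^ q k b =
          den i.castSucc ^ ∑ k ∈ T, q k b := by
        intro T
        induction T using Finset.induction_on with
        | empty => simp
        | insert a T ha ih =>
          rw [Finset.prod_insert ha, Finset.sum_insert ha, zpow_add₀ (hden0 _), ih]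
      obtain ⟨a, ha⟩ := d.nonneg i
      have h4 : ∑ k ∈ P.S i.castSucc, q k b = (a b : ℤ) := by
        have h5 : ∑ k ∈ P.S i.castSucc, q k b = B.repr (L i) ⟨b, hb⟩ := by
          rw [← P.sum_eq i]
          simp [q, hb]
        have h6 : L i = ∑ t : d.E, (a t : ℤ) • B t := by
          rw [ha, ← Finset.sum_coe_sort]
          simp [B]
        rw [h5, h6, B.repr_sum_self]
      rw [h3, h4, zpow_natCast, hdenc]
      exact pow_mem (sum_mem fun k _ => hyA k) _
  have hsum : ∑ j, x j ∈ A := by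
    rw [← Finset.sum_fiberwise Finset.univ blk]
    refine sum_mem fun i _ => ?_
    rw [hfib]
    induction i using Fin.lastCases with
    | last =>
      refine sum_mem fun j hj => ?_
      by_cases hE : j ∈ d.E
      · exact hEA j hE
      · rw [hfree j hj hE]
        exact hyA j
    | cast i =>
      have : ∑ j ∈ P.S i.castSucc, x j = 1 := by
        rw [Finset.sum_congr rfl (hblock i), ← Finset.sum_div]
        exact div_self (d.sum_y_ne_zero _ ⟨_, d.s_mem i⟩)
      rw [this]
      exact one_mem _
  obtain ⟨f, hf⟩ := hsum
  exact ⟨f, x, ⟨hne, hrelx, hblock, hfree⟩, hf⟩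

end PrzyjalkowskiChoice

end

/-!
For `j ∈ S_i ∩ S'_k` draw an edge `i → k` of weight `x_j` on the vertices `1, …, c + 1`. The classes
`∑_{j ∈ S_i} D_j` agree for both partitions, and completeness of the fan then forces every set of
vertices which no edge leaves to be entered by no edge either. Hence the weights have an invariant
measure `h`: the flow `x_j h_{i(j)}`, where `i(j)` is the block of `j`, is conserved at each vertex.
Since the `x_j` are subtraction-free, Gaussian elimination finds `h` without dividing by zero.

The birational map is time reversal, `x'_j = x_j h_{i(j)} / h_{i'(j)}`, where `i'(j)` is the block
of `j` in the second partition. Conservation of the flow says that the sum of the `x'_j` over `S'_k`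
is the sum of the `x_j` over `S_k`; this preserves `∑ x_j` and the equations of the mirror. The
monomial relations are preserved because, the classes being equal, a linear relation among the rays
has the same coefficient sum over `S_k` as over `S'_k`. As reversing time twice is the identity, the
`x'_j` generate the same field.

Differentiating the conservation law shows that `d log x_j ↦ d log x'_j` lifts to a linear map of
determinant `det (-Aᵀ) / det A = ±1`, where `A` is the Laplacian of the flow. The lift matches the
differentials of the block sums, so the residual volume forms agree up to sign.
-/

/-! ### Flows with positive weights on a directed multigraph -/

section Flows

variable {K : Type*} [Field K] {S : Subsemiring K}

/-- The properties of the set of non-negative elements of an ordered field that Gaussian elimination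
needs: closed under inversion, and a sum of two elements vanishes only if both vanish. -/
structure IsPositiveCone (S : Subsemiring K) : Prop where
  inv_mem : ∀ {a}, a ∈ S → a⁻¹ ∈ S
  eq_zero_of_add_eq_zero : ∀ {a b}, a ∈ S → b ∈ S → a + b = 0 → a = 0

namespace IsPositiveCone

theorem div_mem (hS : IsPositiveCone S) {a b : K} (ha : a ∈ S) (hb : b ∈ S) : a / b ∈ S :=
  div_eq_mul_inv a b ▸ mul_mem ha (hS.inv_mem hb)

theorem zpow_mem (hS : IsPositiveCone S) {a : K} (ha : a ∈ S) (z : ℤ) : a ^ z ∈ S := by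
  obtain ⟨k, rfl | rfl⟩ := z.eq_nat_or_neg
  · simpa only [zpow_natCast] using pow_mem ha k
  · simpa only [zpow_neg, zpow_natCast] using hS.inv_mem (pow_mem ha k)

theorem add_ne_zero (hS : IsPositiveCone S) {a b : K} (ha : a ∈ S) (hb : b ∈ S) (ha0 : a ≠ 0) :
    a + b ≠ 0 :=
  fun h => ha0 (hS.eq_zero_of_add_eq_zero ha hb h)

theorem sum_eq_zero_iff (hS : IsPositiveCone S) {ι : Type*} {s : Finset ι} {a : ι → K}
    (ha : ∀ i ∈ s, a i ∈ S) : ∑ i ∈ s, a i = 0 ↔ ∀ i ∈ s, a i = 0 := by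
  classical
  refine ⟨fun h i hi => ?_, Finset.sum_eq_zero⟩
  rw [← Finset.add_sum_erase s a hi] at h
  exact hS.eq_zero_of_add_eq_zero (ha i hi)
    (sum_mem fun k hk => ha k (Finset.mem_of_mem_erase hk)) h

end IsPositiveCone

section Elimination

variable {V : Type*} [Fintype V] [DecidableEq V]

/-- A finite set `ν` of vertices is transient for the weights `X i k` of the edges `i → k` if every
non-empty subset of `ν` can be left along an edge of non-zero weight. -/
def IsTransient (X : V → V → K) (ν : Finset V) : Prop :=
  ∀ I ⊆ ν, I.Nonempty → ∃ i ∈ I, ∃ k ∉ I, X i k ≠ 0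

/-- The weights after elimination of the vertex `v`: every path `i → v → k` becomes an edge, and
the loops at `v` are forgotten. -/
def eliminate (X : V → V → K) (v i k : V) : K :=
  if i = v ∨ k = v then 0 else X i k + X i v * X v k / ∑ l with l ≠ v, X v l

theorem eliminate_of_ne (X : V → V → K) {v i k : V} (hi : i ≠ v) (hk : k ≠ v) :
    eliminate X v i k = X i k + X i v * X v k / ∑ l with l ≠ v, X v l :=
  if_neg (not_or.2 ⟨hi, hk⟩)

theorem eliminate_mem (hS : IsPositiveCone S) {X : V → V → K} (hX : ∀ i k, X i k ∈ S)
    (v i k : V) : eliminate X v i k ∈ S := by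
  unfold eliminate
  split_ifs
  · exact zero_mem S
  · exact add_mem (hX i k) (hS.div_mem (mul_mem (hX i v) (hX v k)) (sum_mem fun l _ => hX v l))

theorem sum_eliminate {X : V → V → K} {v i : V} (hv : ∑ l with l ≠ v, X v l ≠ 0) (hi : i ≠ v) :
    ∑ k, eliminate X v i k = ∑ k, X i k := by
  calc ∑ k, eliminate X v i k = ∑ k with k ≠ v, eliminate X v i k := by
        rw [Finset.sum_filter_of_ne]
        rintro k - hk rfl
        exact hk (if_pos (Or.inr rfl))
    _ = ∑ k with k ≠ v, (X i k + X i v * X v k / ∑ l with l ≠ v, X v l) :=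
        Finset.sum_congr rfl fun k hk => eliminate_of_ne X hi (Finset.mem_filter.1 hk).2
    _ = ∑ k with k ≠ v, X i k + X i v := by
        rw [Finset.sum_add_distrib, ← Finset.sum_div, ← Finset.mul_sum, mul_div_cancel_right₀ _ hv]
    _ = ∑ k, X i k := by
        rw [Finset.filter_ne', Finset.sum_erase_add _ _ (Finset.mem_univ v)]

theorem IsTransient.sum_ne_zero {X : V → V → K} {ν : Finset V} (hν : IsTransient X ν)
    (hS : IsPositiveCone S) (hX : ∀ i k, X i k ∈ S) {v : V} (hv : v ∈ ν) :
    ∑ l with l ≠ v, X v l ≠ 0 := by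
  obtain ⟨i, hi, k, hk, hik⟩ :=
    hν {v} (Finset.singleton_subset_iff.2 hv) (Finset.singleton_nonempty v)
  obtain rfl := Finset.mem_singleton.1 hi
  intro h
  exact hik ((hS.sum_eq_zero_iff fun l _ => hX i l).1 h k
    (by simpa only [Finset.mem_filter, Finset.mem_univ, true_and, Finset.mem_singleton] using hk))

theorem IsTransient.eliminate {X : V → V → K} {v : V} {ν : Finset V}
    (hν : IsTransient X (insert v ν)) (hv : v ∉ ν) (hS : IsPositiveCone S)
    (hX : ∀ i k, X i k ∈ S) : IsTransient (eliminate X v) ν := by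
  intro I hI hne
  have hp : ∑ l with l ≠ v, X v l ≠ 0 := hν.sum_ne_zero hS hX (Finset.mem_insert_self v ν)
  have hdetour : ∀ i k, X i v * X v k / ∑ l with l ≠ v, X v l ∈ S := fun i k =>
    hS.div_mem (mul_mem (hX i v) (hX v k)) (sum_mem fun l _ => hX v l)
  have hIv : ∀ i ∈ I, i ≠ v := fun i hi => ne_of_mem_of_not_mem (hI hi) hv
  obtain ⟨i, hi, k, hk, hik⟩ := hν I (hI.trans (Finset.subset_insert v ν)) hne
  by_cases hkv : k = v
  · subst hkv
    obtain ⟨i', hi', k', hk', hik'⟩ :=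
      hν (insert k I) (Finset.insert_subset_insert k hI) (Finset.insert_nonempty k I)
    rw [Finset.mem_insert, not_or] at hk'
    rcases Finset.mem_insert.1 hi' with rfl | hi'
    · refine ⟨i, hi, k', hk'.2, ?_⟩
      rw [eliminate_of_ne X (hIv i hi) hk'.1, add_comm]
      exact hS.add_ne_zero (hdetour i k') (hX i k') (div_ne_zero (mul_ne_zero hik hik') hp)
    · refine ⟨i', hi', k', hk'.2, ?_⟩
      rw [eliminate_of_ne X (hIv i' hi') hk'.1]
      exact hS.add_ne_zero (hX i' k') (hdetour i' k') hik'
  · refine ⟨i, hi, k, hk, ?_⟩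
    rw [eliminate_of_ne X (hIv i hi) hkv]
    exact hS.add_ne_zero (hX i k) (hdetour i k) hik

theorem stationary_add_single {X : V → V → K} {ν : Finset V} {v : V} (hv : v ∉ ν)
    (hp : ∑ l with l ≠ v, X v l ≠ 0) {g h : V → K} (h0 : h v = 0) {q : K}
    (hq : q * ∑ l with l ≠ v, X v l = ∑ i, X i v * h i + g v)
    (hh : ∀ k ∈ ν, (∑ l, eliminate X v k l) * h k =
      ∑ i, eliminate X v i k * h i + (g k + g v * X v k / ∑ l with l ≠ v, X v l)) :
    ∀ k ∈ insert v ν, (∑ l, X k l) * (h + Pi.single v q : V → K) k =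
      ∑ i, X i k * (h + Pi.single v q : V → K) i + g k := by
  set p := ∑ l with l ≠ v, X v l with hpdef
  intro k hk
  have hsum : ∑ i, X i k * (h + Pi.single v q : V → K) i = ∑ i, X i k * h i + X v k * q := by
    simp only [Pi.add_apply, mul_add, Finset.sum_add_distrib, Pi.single_apply, mul_ite, mul_zero,
      Finset.sum_ite_eq', Finset.mem_univ, if_true]
  rw [hsum, Pi.add_apply]
  rcases Finset.mem_insert.1 hk with rfl | hkν
  · have hrow : ∑ l, X k l = p + X k k := by
      rw [hpdef, Finset.filter_ne', Finset.sum_erase_add _ _ (Finset.mem_univ k)]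
    rw [hrow, h0, Pi.single_eq_same]
    linear_combination hq
  · have hkv : k ≠ v := ne_of_mem_of_not_mem hkν hv
    have hinflow : ∑ i, eliminate X v i k * h i =
        ∑ i, X i k * h i + (∑ i, X i v * h i) * (X v k / p) := by
      rw [Finset.sum_mul, ← Finset.sum_add_distrib]
      refine Finset.sum_congr rfl fun i _ => ?_
      by_cases hi : i = v
      · simp only [hi, h0, mul_zero, zero_mul, add_zero]
      · rw [eliminate_of_ne X hi hkv]
        ring
    rw [Pi.single_eq_of_ne hkv, add_zero, ← sum_eliminate hp hkv, hh k hkν, hinflow,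
      eq_div_of_mul_eq hp hq]
    ring

end Elimination

/-- Gaussian elimination without subtraction. -/
theorem IsTransient.exists_stationary {V : Type*} [Fintype V] (hS : IsPositiveCone S)
    {ν : Finset V} :
    ∀ {X : V → V → K}, (∀ i k, X i k ∈ S) → IsTransient X ν → ∀ {g : V → K}, (∀ k, g k ∈ S) →
      ∃ h : V → K, (∀ k, h k ∈ S) ∧ (∀ k ∉ ν, h k = 0) ∧
        ∀ k ∈ ν, (∑ l, X k l) * h k = ∑ i, X i k * h i + g k := by
  classical
  induction ν using Finset.induction_on with
  | empty =>
    intro X _ _ g _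
    exact ⟨0, fun _ => zero_mem S, fun _ _ => rfl, fun k hk => absurd hk (Finset.notMem_empty k)⟩
  | insert v ν hv ih =>
    intro X hX hν g hg
    have hp := hν.sum_ne_zero hS hX (Finset.mem_insert_self v ν)
    have hpS : ∑ l with l ≠ v, X v l ∈ S := sum_mem fun l _ => hX v l
    obtain ⟨h, hhS, hh0, hh⟩ := ih (eliminate_mem hS hX v) (hν.eliminate hv hS hX)
      (g := fun k => g k + g v * X v k / ∑ l with l ≠ v, X v l)
      fun k => add_mem (hg k) (hS.div_mem (mul_mem (hg v) (hX v k)) hpS)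
    refine ⟨_, fun k => ?_, fun k hk => ?_,
      stationary_add_single hv hp (hh0 v hv) (div_mul_cancel₀ _ hp) hh⟩
    · rw [Pi.add_apply, Pi.single_apply]
      refine add_mem (hhS k) ?_
      split_ifs
      · exact hS.div_mem (add_mem (sum_mem fun i _ => mul_mem (hX i v) (hhS i)) (hg v)) hpS
      · exact zero_mem S
    · rw [Finset.mem_insert, not_or] at hk
      rw [Pi.add_apply, hh0 k hk.2, Pi.single_eq_of_ne hk.1, add_zero]

section Multigraph

variable {ι V : Type*} {b b' : ι → V} {ν : Finset V}

/-- A set of vertices of the multigraph with one edge `b j → b' j` for every `j` is saturated if it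
is a union of connected components. -/
def IsSaturated (b b' : ι → V) (I : Finset V) : Prop :=
  ∀ j, b j ∈ I ↔ b' j ∈ I

/-- The multigraph with one edge `b j → b' j` for every `j` is balanced if a set of vertices that no
edge leaves is entered by no edge either. -/
def IsBalanced (b b' : ι → V) : Prop :=
  ∀ I : Finset V, (∀ j, b j ∈ I → b' j ∈ I) → ∀ j, b' j ∈ I → b j ∈ I

/-- `ν` consists of all vertices but exactly one, the root, of every connected component of the
multigraph with one edge `b j → b' j` for every `j`. -/
structure IsReducing (b b' : ι → V) (ν : Finset V) : Prop where
  eq_empty : ∀ I ⊆ ν, IsSaturated b b' I → I = ∅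
  exists_component : ∀ k ∉ ν, ∃ C, IsSaturated b b' C ∧ k ∈ C ∧ ∀ i ∈ C, i ≠ k → i ∈ ν

theorem IsSaturated.symm {I : Finset V} (hI : IsSaturated b b' I) : IsSaturated b' b I :=
  fun j => (hI j).symm

theorem IsBalanced.isSaturated (hb : IsBalanced b b') {I : Finset V}
    (hI : ∀ j, b j ∈ I → b' j ∈ I) : IsSaturated b b' I :=
  fun j => ⟨hI j, hb I hI j⟩

theorem IsBalanced.symm [Finite V] (hb : IsBalanced b b') : IsBalanced b' b := by
  classical
  cases nonempty_fintype V
  intro I hI j hj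
  by_contra hj'
  refine Finset.mem_compl.1 (hb Iᶜ (fun l hl => ?_) j (Finset.mem_compl.2 hj')) hj
  exact Finset.mem_compl.2 fun hl' => Finset.mem_compl.1 hl (hI l hl')

theorem IsReducing.symm (hν : IsReducing b b' ν) : IsReducing b' b ν where
  eq_empty I hI hI' := hν.eq_empty I hI hI'.symm
  exists_component k hk :=
    let ⟨C, hC, h⟩ := hν.exists_component k hk
    ⟨C, hC.symm, h⟩

theorem exists_isReducing [Finite V] (b b' : ι → V) : ∃ ν : Finset V, IsReducing b b' ν := by
  classical
  cases nonempty_fintype V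
  let r : Setoid V := Relation.EqvGen.setoid fun i k => ∃ j, b j = i ∧ b' j = k
  let root : V → V := fun k => (Quotient.mk r k).out
  have hroot : ∀ k, r (root k) k := fun k => Quotient.mk_out k
  have hroot_eq : ∀ {i k}, r i k → root i = root k := fun h =>
    congrArg Quotient.out (Quotient.sound h)
  have hedge : ∀ j, r (b j) (b' j) := fun j => .rel _ _ ⟨j, rfl, rfl⟩
  refine ⟨Finset.univ.filter fun k => root k ≠ k, fun I hI hsat => ?_, fun k hk => ?_⟩
  · have hr : ∀ {i k}, r i k → (i ∈ I ↔ k ∈ I) := fun h => by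
      induction h with
      | rel _ _ h => obtain ⟨j, rfl, rfl⟩ := h; exact hsat j
      | refl _ => rfl
      | symm _ _ _ ih => exact ih.symm
      | trans _ _ _ _ _ ih ih' => exact ih.trans ih'
    refine Finset.eq_empty_of_forall_notMem fun i hi => ?_
    exact (Finset.mem_filter.1 (hI ((hr (hroot i)).2 hi))).2 (hroot_eq (hroot i))
  · have hk : root k = k := by simpa using hk
    refine ⟨Finset.univ.filter fun i => r i k, fun j => ?_, by simp, fun i hi hik => ?_⟩
    · simp only [Finset.mem_filter, Finset.mem_univ, true_and]
      exact ⟨r.trans (r.symm (hedge j)), r.trans (hedge j)⟩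
    · have hi : r i k := by simpa using hi
      simpa [hroot_eq hi, hk] using hik.symm

end Multigraph

section Divergence

variable {ι V : Type*} [Fintype ι] [DecidableEq V] {b b' : ι → V} {ν : Finset V}
  {W : Type*} [AddCommGroup W]

/-- The net outflow at the vertex `k` of the flow `g` along the edges `b j → b' j`. -/
def divergence (b b' : ι → V) (g : ι → W) (k : V) : W :=
  ∑ j with b j = k, g j - ∑ j with b' j = k, g j

theorem divergence_swap (g : ι → W) (k : V) : divergence b' b g k = -divergence b b' g k :=
  (neg_sub _ _).symm

theorem divergence_add (g g' : ι → W) (k : V) :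
    divergence b b' (fun j => g j + g' j) k = divergence b b' g k + divergence b b' g' k := by
  simp only [divergence, Finset.sum_add_distrib]
  abel

theorem map_divergence {U F : Type*} [AddCommGroup U] [FunLike F W U] [AddMonoidHomClass F W U]
    (φ : F) (g : ι → W) (k : V) :
    φ (divergence b b' g k) = divergence b b' (fun j => φ (g j)) k := by
  simp only [divergence, map_sub, map_sum]

theorem IsReducing.divergence_eq_zero (hν : IsReducing b b' ν) {g : ι → W}
    (hg : ∀ k ∈ ν, divergence b b' g k = 0) (k : V) : divergence b b' g k = 0 := by
  by_cases hk : k ∈ ν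
  · exact hg k hk
  obtain ⟨C, hC, hkC, hCν⟩ := hν.exists_component k hk
  calc divergence b b' g k = ∑ i ∈ C, divergence b b' g i :=
        (Finset.sum_eq_single_of_mem k hkC fun i hi hik => hg i (hCν i hi hik)).symm
    _ = ∑ j with b j ∈ C, g j - ∑ j with b' j ∈ C, g j := by
        simp only [divergence, Finset.sum_sub_distrib, Finset.sum_fiberwise_eq_sum_filter]
    _ = 0 := by simp only [hC _, sub_self]

end Divergence

section Laplacian

open scoped Matrix.Module

variable {ι V : Type*} [Fintype ι] [DecidableEq V] {b b' : ι → V} {ν : Finset V} {x : ι → K}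

/-- The Laplacian of the edges `b j → b' j` with weights `x j`, with the vertices outside `ν`
deleted: the matrix of `h ↦ div (x j * h (b j))`. -/
def laplacian (b b' : ι → V) (ν : Finset V) (x : ι → K) : Matrix ν ν K :=
  .of fun k i => divergence b b' (fun j => if b j = i then x j else 0) k

theorem laplacian_smul {W : Type*} [AddCommGroup W] [Module K W] {η : V → W}
    (hη : ∀ k ∉ ν, η k = 0) :
    laplacian b b' ν x • (fun i : ν => η i) =
      fun k : ν => divergence b b' (fun j => x j • η (b j)) k := by
  have hsum : ∀ j, ∑ i : ν, (if b j = i then x j else 0) • η i = x j • η (b j) := fun j => by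
    rw [Finset.sum_coe_sort ν fun i => (if b j = i then x j else 0) • η i]
    simp only [ite_smul, zero_smul, Finset.sum_ite_eq, ite_eq_left_iff]
    exact fun hj => by rw [hη _ hj, smul_zero]
  funext k
  simp only [Matrix.Module.smul_apply, laplacian, Matrix.of_apply, divergence, sub_smul,
    Finset.sum_smul, Finset.sum_sub_distrib]
  rw [Finset.sum_comm, Finset.sum_comm (s := Finset.univ (α := ν))]
  simp only [hsum]

theorem IsReducing.isTransient (hν : IsReducing b b' ν) (hb : IsBalanced b b')
    (hS : IsPositiveCone S) (hx : ∀ j, x j ∈ S) (hx0 : ∀ j, x j ≠ 0) :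
    IsTransient (fun i k => ∑ j with b j = i ∧ b' j = k, x j) ν := by
  intro I hI hne
  by_contra! hstay
  refine hne.ne_empty (hν.eq_empty I hI (hb.isSaturated fun j hj => ?_))
  by_contra hj'
  exact hx0 j ((hS.sum_eq_zero_iff fun l _ => hx l).1 (hstay _ hj _ hj') j (by simp))

variable [Finite V]

theorem IsReducing.exists_divergence_eq (hν : IsReducing b b' ν) (hb : IsBalanced b b')
    (hS : IsPositiveCone S) (hx : ∀ j, x j ∈ S) (hx0 : ∀ j, x j ≠ 0) {g : V → K}
    (hg : ∀ k, g k ∈ S) : ∃ h : V → K, (∀ k, h k ∈ S) ∧ (∀ k ∉ ν, h k = 0) ∧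
      ∀ k ∈ ν, divergence b b' (fun j => x j * h (b j)) k = g k := by
  cases nonempty_fintype V
  obtain ⟨h, hhS, hh0, hh⟩ := (hν.isTransient hb hS hx hx0).exists_stationary hS
    (fun i k => sum_mem fun j _ => hx j) hg
  refine ⟨h, hhS, hh0, fun k hk => ?_⟩
  have hout : (∑ l, ∑ j with b j = k ∧ b' j = l, x j) * h k = ∑ j with b j = k, x j * h (b j) := by
    simp only [← Finset.filter_filter, Finset.sum_fiberwise, Finset.sum_mul]
    exact Finset.sum_congr rfl fun j hj => by rw [(Finset.mem_filter.1 hj).2]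
  have hin : ∑ i, (∑ j with b j = i ∧ b' j = k, x j) * h i =
      ∑ j with b' j = k, x j * h (b j) := by
    rw [← Finset.sum_fiberwise _ b]
    refine Finset.sum_congr rfl fun i _ => ?_
    rw [Finset.sum_mul, Finset.filter_filter]
    simp only [and_comm (a := b' _ = k)]
    exact Finset.sum_congr rfl fun j hj => by rw [(Finset.mem_filter.1 hj).2.1]
  rw [divergence, ← hout, hh k hk, hin, add_sub_cancel_left]

theorem IsReducing.isUnit_laplacian (hν : IsReducing b b' ν) (hb : IsBalanced b b')
    (hS : IsPositiveCone S) (hx : ∀ j, x j ∈ S) (hx0 : ∀ j, x j ≠ 0) :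
    IsUnit (laplacian b b' ν x) := by
  choose h _ hh0 hh using fun l : V => hν.exists_divergence_eq hb hS hx hx0
    (g := Pi.single l 1) fun k => by
      rw [Pi.single_apply]
      split_ifs
      exacts [one_mem S, zero_mem S]
  refine .of_mul_eq_one (.of fun i l => h l i) (Matrix.ext fun k l => ?_)
  calc (laplacian b b' ν x * Matrix.of fun i l : ν => h l i) k l
      = (laplacian b b' ν x • fun i : ν => h l i) k := rfl
    _ = (1 : Matrix ν ν K) k l := by
      rw [laplacian_smul (hh0 l)]
      simp only [smul_eq_mul, hh l k k.2, Pi.single_apply, Matrix.one_apply, Subtype.ext_iff]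

end Laplacian

section FlowExchange

open scoped Matrix.Module

variable {ι V : Type*} [Fintype ι] [DecidableEq V] {b b' : ι → V} {ν : Finset V} {x x' : ι → K}
  {h : V → K}

theorem prod_comp_zpow [Fintype V] (hh : ∀ k, h k ≠ 0) (b : ι → V) (l : ι → ℤ) :
    ∏ j, h (b j) ^ l j = ∏ k, h k ^ ∑ j with b j = k, l j := by
  classical
  have hsum : ∀ (k : V) (s : Finset ι), ∏ j ∈ s, h k ^ l j = h k ^ ∑ j ∈ s, l j := fun k s => by
    induction s using Finset.induction_on with
    | empty => simp
    | insert j s hj ih => rw [Finset.prod_insert hj, Finset.sum_insert hj, zpow_add₀ (hh k), ih]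
  rw [← Finset.prod_fiberwise Finset.univ b]
  refine Finset.prod_congr rfl fun k _ => ?_
  rw [← hsum]
  exact Finset.prod_congr rfl fun j hj => by rw [(Finset.mem_filter.1 hj).2]

/-- The weights `x` of the edges `b j → b' j` and the weights `x'` of the reversed edges
`b' j → b j` carry the same conserved flow, for the same potential `h`, which is normalized at the
roots. If the `x j` are transition probabilities, then `h` is a stationary distribution and the
`x' j` are the transition probabilities of the time-reversed Markov chain. -/
structure IsFlowExchange (b b' : ι → V) (ν : Finset V) (x x' : ι → K) (h : V → K) : Prop where
  potential_ne_zero : ∀ k, h k ≠ 0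
  potential_eq_one : ∀ k ∉ ν, h k = 1
  flow_eq : ∀ j, x j * h (b j) = x' j * h (b' j)
  divergence_eq_zero : ∀ k, divergence b b' (fun j => x j * h (b j)) k = 0

namespace IsFlowExchange

theorem symm (H : IsFlowExchange b b' ν x x' h) : IsFlowExchange b' b ν x' x h where
  potential_ne_zero := H.potential_ne_zero
  potential_eq_one := H.potential_eq_one
  flow_eq j := (H.flow_eq j).symm
  divergence_eq_zero k := by
    rw [divergence_swap, neg_eq_zero]
    simpa only [H.flow_eq] using H.divergence_eq_zero k

theorem flow_ne_zero (H : IsFlowExchange b b' ν x x' h) {j : ι} (hx : x j ≠ 0) :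
    x j * h (b j) ≠ 0 :=
  mul_ne_zero hx (H.potential_ne_zero _)

theorem eq_mul_div (H : IsFlowExchange b b' ν x x' h) (j : ι) :
    x' j = x j * (h (b j) / h (b' j)) := by
  rw [← mul_div_assoc, H.flow_eq, mul_div_cancel_right₀ _ (H.potential_ne_zero _)]

theorem sum_eq (H : IsFlowExchange b b' ν x x' h) (k : V) :
    ∑ j with b' j = k, x' j = ∑ j with b j = k, x j := by
  refine mul_right_cancel₀ (H.potential_ne_zero k) ?_
  calc (∑ j with b' j = k, x' j) * h k = ∑ j with b' j = k, x j * h (b j) := by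
        rw [Finset.sum_mul]
        exact Finset.sum_congr rfl fun j hj => by rw [H.flow_eq, (Finset.mem_filter.1 hj).2]
    _ = ∑ j with b j = k, x j * h (b j) := (sub_eq_zero.1 (H.divergence_eq_zero k)).symm
    _ = (∑ j with b j = k, x j) * h k := by
        rw [Finset.sum_mul]
        exact Finset.sum_congr rfl fun j hj => by rw [(Finset.mem_filter.1 hj).2]

theorem prod_zpow_eq [Finite V] (H : IsFlowExchange b b' ν x x' h) {l : ι → ℤ}
    (hl : ∀ k, divergence b b' l k = 0) : ∏ j, x' j ^ l j = ∏ j, x j ^ l j := by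
  have hcomp : ∏ j, h (b j) ^ l j = ∏ j, h (b' j) ^ l j := by
    cases nonempty_fintype V
    rw [prod_comp_zpow H.potential_ne_zero b, prod_comp_zpow H.potential_ne_zero b']
    exact Finset.prod_congr rfl fun k _ => congrArg (h k ^ ·) (sub_eq_zero.1 (hl k))
  refine mul_right_cancel₀ (b := ∏ j, h (b' j) ^ l j)
    (Finset.prod_ne_zero_iff.2 fun j _ => zpow_ne_zero _ (H.potential_ne_zero _)) ?_
  rw [← Finset.prod_mul_distrib]
  simp only [← mul_zpow, ← H.flow_eq]
  simp only [mul_zpow, Finset.prod_mul_distrib, hcomp]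

theorem potential_mem (H : IsFlowExchange b b' ν x x' h) (hL : IsUnit (laplacian b b' ν x))
    {F : Subfield K} (hF : ∀ j, x j ∈ F) (k : V) : h k ∈ F := by
  have hdiv : ∀ {g : ι → K}, (∀ j, g j ∈ F) → ∀ k, divergence b b' g k ∈ F := fun hg k =>
    sub_mem (sum_mem fun j _ => hg j) (sum_mem fun j _ => hg j)
  have hite : ∀ (p : Prop) [Decidable p] {a : K}, a ∈ F → (if p then a else 0) ∈ F :=
    fun p _ _ ha => by split_ifs; exacts [ha, zero_mem F]
  by_cases hk : k ∈ ν
  swap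
  · exact H.potential_eq_one k hk ▸ one_mem F
  let η : V → K := fun i => if i ∈ ν then h i else 0
  let g : ν → K := fun l => divergence b b' (fun j => if b j ∉ ν then x j else 0) l
  have hη : laplacian b b' ν x • (fun i : ν => η i) = -g := by
    have hsplit : ∀ j, x j • η (b j) + (if b j ∉ ν then x j else 0) = x j * h (b j) := fun j => by
      by_cases hj : b j ∈ ν
      · simp only [η, hj, if_true, smul_eq_mul, not_true, if_false, add_zero]
      · simp only [η, hj, if_false, smul_zero, not_false_eq_true, if_true, zero_add,
          H.potential_eq_one _ hj, mul_one]
    rw [laplacian_smul fun i hi => if_neg hi]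
    funext l
    rw [Pi.neg_apply, eq_neg_iff_add_eq_zero, ← divergence_add]
    exact (congrArg (divergence b b' · (l : V)) (funext hsplit)).trans (H.divergence_eq_zero l)
  have hinv : (laplacian b b' ν x)⁻¹ * laplacian b b' ν x = 1 :=
    Matrix.nonsing_inv_mul _ ((Matrix.isUnit_iff_isUnit_det _).1 hL)
  have hsolve : h k = ((laplacian b b' ν x)⁻¹ • -g) ⟨k, hk⟩ := by
    rw [← hη, smul_smul, hinv, one_smul]
    exact (if_pos hk).symm
  rw [hsolve]
  refine sum_mem fun l _ => mul_mem ?_ (neg_mem (hdiv (fun j => hite _ (hF j)) l))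
  exact Matrix.mem_subfield_of_mul_eq_one_of_mem_subfield_left (.refl ν) F hinv
    (fun i k => hdiv (fun j => hite _ (hF j)) i) _ _

end IsFlowExchange

theorem IsReducing.potential_ne_zero [Finite V] (hν : IsReducing b b' ν) (hb : IsBalanced b b')
    (hS : IsPositiveCone S) (hx : ∀ j, x j ∈ S) (hx0 : ∀ j, x j ≠ 0) (hh : ∀ k, h k ∈ S)
    (hroot : ∀ k ∉ ν, h k ≠ 0) (hdiv : ∀ k, divergence b b' (fun j => x j * h (b j)) k = 0)
    (k : V) : h k ≠ 0 := by
  classical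
  cases nonempty_fintype V
  have hpred : ∀ j, h (b' j) = 0 → h (b j) = 0 := by
    intro j hj
    have hout : ∑ l with b l = b' j, x l * h (b l) = 0 :=
      Finset.sum_eq_zero fun l hl => by rw [(Finset.mem_filter.1 hl).2, hj, mul_zero]
    have hin : ∑ l with b' l = b' j, x l * h (b l) = 0 :=
      (sub_eq_zero.1 (hdiv (b' j))).symm.trans hout
    exact (mul_eq_zero.1 ((hS.sum_eq_zero_iff fun l _ => mul_mem (hx l) (hh (b l))).1 hin j
      (by simp))).resolve_left (hx0 j)
  have hempty : Finset.univ.filter (fun k => h k = 0) = ∅ := by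
    refine hν.eq_empty _ (fun k hk => ?_) (hb.symm.isSaturated fun j => ?_).symm
    · by_contra hkν
      exact hroot k hkν (Finset.mem_filter.1 hk).2
    · simpa only [Finset.mem_filter, Finset.mem_univ, true_and] using hpred j
  intro hk
  exact Finset.notMem_empty k (hempty ▸ Finset.mem_filter.2 ⟨Finset.mem_univ k, hk⟩)

theorem IsReducing.exists_isFlowExchange [Finite V] (hν : IsReducing b b' ν)
    (hb : IsBalanced b b') (hS : IsPositiveCone S) (hx : ∀ j, x j ∈ S) (hx0 : ∀ j, x j ≠ 0) :
    ∃ (x' : ι → K) (h : V → K), IsFlowExchange b b' ν x x' h ∧ ∀ k, h k ∈ S := by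
  obtain ⟨δ, hδS, hδ0, hδ⟩ := hν.exists_divergence_eq hb hS hx hx0
    (g := fun k => ∑ j with b' j = k, if b j ∈ ν then 0 else x j)
    fun k => sum_mem fun j _ => by split_ifs; exacts [zero_mem S, hx j]
  let h : V → K := fun k => if k ∈ ν then δ k else 1
  have hroot : ∀ k ∉ ν, h k = 1 := fun k hk => if_neg hk
  have hhS : ∀ k, h k ∈ S := fun k => by
    simp only [h]
    split_ifs
    exacts [hδS k, one_mem S]
  have hsplit : ∀ j, x j * h (b j) = x j * δ (b j) + if b j ∈ ν then 0 else x j := fun j => by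
    by_cases hj : b j ∈ ν
    · simp only [h, if_pos hj, add_zero]
    · simp only [h, if_neg hj, hδ0 _ hj, mul_one, mul_zero, zero_add]
  have hdiv : ∀ k, divergence b b' (fun j => x j * h (b j)) k = 0 := by
    refine hν.divergence_eq_zero fun k hk => ?_
    have hout : ∑ j with b j = k, (if b j ∈ ν then 0 else x j) = 0 :=
      Finset.sum_eq_zero fun j hj => if_pos ((Finset.mem_filter.1 hj).2 ▸ hk)
    simp only [hsplit, divergence_add, hδ k hk]
    rw [divergence, hout, zero_sub, add_neg_cancel]
  have hh0 : ∀ k, h k ≠ 0 := hν.potential_ne_zero hb hS hx hx0 hhS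
    (fun k hk => hroot k hk ▸ one_ne_zero) hdiv
  exact ⟨fun j => x j * h (b j) / h (b' j), h,
    ⟨hh0, hroot, fun j => (div_mul_cancel₀ _ (hh0 _)).symm, hdiv⟩, hhS⟩

end FlowExchange

section RankUpdate

variable {W : Type*} [AddCommGroup W] [Module K W]

theorem det_id_add_sum_smulRight [FiniteDimensional K W] {κ : Type*} [Fintype κ] [DecidableEq κ]
    (m : κ → Module.Dual K W) (η : κ → W) :
    LinearMap.det (LinearMap.id + ∑ i, (m i).smulRight (η i)) =
      (1 + Matrix.of fun k i => m k (η i)).det := by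
  let B := Module.finBasis K W
  let e := Pi.basisFun K κ
  have hcomp : ∑ i, (m i).smulRight (η i) = Fintype.linearCombination K η ∘ₗ LinearMap.pi m := by
    ext w
    simp [Fintype.linearCombination_apply]
  rw [← LinearMap.det_toMatrix B, map_add, LinearMap.toMatrix_id, hcomp,
    LinearMap.toMatrix_comp B e, Matrix.det_one_add_mul_comm]
  congr 2
  ext k i
  rw [← LinearMap.toMatrix_comp e B, LinearMap.toMatrix_apply]
  simp [e]

theorem id_add_sum_smulRight_apply {ι V : Type*} [Finite V] [DecidableEq V] {b b' : ι → V}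
    {ν : Finset V} {v : ι → W} {η : V → W} (hη : ∀ k ∉ ν, η k = 0)
    {m : V → Module.Dual K W}
    (hm : ∀ k j, m k (v j) = (if b j = k then 1 else 0) - if b' j = k then 1 else 0) (j : ι) :
    (LinearMap.id + ∑ i : ν, (m i).smulRight (η i) : W →ₗ[K] W) (v j) =
      v j + η (b j) - η (b' j) := by
  cases nonempty_fintype V
  simp only [LinearMap.add_apply, LinearMap.id_apply, LinearMap.sum_apply,
    LinearMap.smulRight_apply]
  rw [Finset.sum_coe_sort ν fun i => m i (v j) • η i,
    Finset.sum_subset (Finset.subset_univ ν) fun i _ hi => by rw [hη i hi, smul_zero]]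
  simp only [hm, sub_smul, ite_smul, one_smul, zero_smul, Finset.sum_sub_distrib,
    Finset.sum_ite_eq, Finset.mem_univ, if_true, add_sub_assoc]

end RankUpdate

section Linearization

open scoped Matrix.Module

variable {ι V W : Type*} [Fintype ι] [DecidableEq V] [AddCommGroup W] [Module K W] {b b' : ι → V}
  {ν : Finset V} {f : ι → K}

theorem laplacian_swap (hf : ∀ k, divergence b b' f k = 0) :
    laplacian b' b ν f = (laplacian b b' ν f).transpose := by
  ext k l
  have hdiag : ∑ j with b' j = k, (if b' j = (l : V) then f j else 0) =
      ∑ j with b j = k, if b j = (l : V) then f j else 0 := by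
    simp only [Finset.sum_filter, ← ite_and]
    by_cases hkl : (k : V) = l
    · simpa only [hkl, and_self, Finset.sum_filter] using (sub_eq_zero.1 (hf l)).symm
    · rw [Finset.sum_eq_zero fun j _ => if_neg fun h => hkl (h.1.symm.trans h.2),
        Finset.sum_eq_zero fun j _ => if_neg fun h => hkl (h.1.symm.trans h.2)]
  have hoff : ∑ j with b j = k, (if b' j = (l : V) then f j else 0) =
      ∑ j with b' j = l, if b j = (k : V) then f j else 0 := by
    simp only [Finset.sum_filter, ← ite_and, and_comm]
  have hdiag' : ∑ j with b j = k, (if b j = (l : V) then f j else 0) =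
      ∑ j with b j = l, if b j = (k : V) then f j else 0 := by
    simp only [Finset.sum_filter, ← ite_and, and_comm]
  rw [Matrix.transpose_apply, laplacian, Matrix.of_apply, divergence, hdiag, hdiag', hoff]
  rfl

theorem eq_zero_of_divergence_eq_zero (hL : IsUnit (laplacian b b' ν f)) {η : V → W}
    (hη : ∀ k ∉ ν, η k = 0) (hdiv : ∀ k ∈ ν, divergence b b' (fun j => f j • η (b j)) k = 0)
    (k : V) : η k = 0 := by
  by_cases hk : k ∈ ν
  swap
  · exact hη k hk
  have hzero : laplacian b b' ν f • (fun i : ν => η i) = 0 :=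
    (laplacian_smul hη).trans (funext fun i => hdiv i i.2)
  exact congrFun (hL.smul_eq_zero.1 hzero) ⟨k, hk⟩

theorem IsReducing.exists_divergence_smul_eq_zero (hν : IsReducing b b' ν)
    (hL : IsUnit (laplacian b b' ν f)) (v : ι → W) : ∃ η : V → W, (∀ k ∉ ν, η k = 0) ∧
      ∀ k, divergence b b' (fun j => f j • (v j + η (b j))) k = 0 := by
  obtain ⟨u, hu⟩ := hL
  let g : ν → W := fun k => -divergence b b' (fun j => f j • v j) k
  let η : V → W := fun k => if hk : k ∈ ν then (u⁻¹ • g) ⟨k, hk⟩ else 0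
  have hη : ∀ k ∉ ν, η k = 0 := fun k hk => dif_neg hk
  have hsolve : laplacian b b' ν f • (fun i : ν => η i) = g := by
    rw [← hu, show (fun i : ν => η i) = u⁻¹ • g from funext fun i => dif_pos i.2]
    exact smul_inv_smul u g
  refine ⟨η, hη, hν.divergence_eq_zero fun k hk => ?_⟩
  have hk' := congrFun ((laplacian_smul hη).symm.trans hsolve) ⟨k, hk⟩
  simp only [smul_add, divergence_add, hk', g, add_neg_cancel]

theorem det_one_add_of_divergence_eq_zero (hf : ∀ k, divergence b b' f k = 0)
    (hL : IsUnit (laplacian b b' ν f)) {v : ι → W} {η : V → W} (hη : ∀ k ∉ ν, η k = 0)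
    (hdiv : ∀ k ∈ ν, divergence b b' (fun j => f j • (v j + η (b j))) k = 0)
    {m : V → Module.Dual K W}
    (hm : ∀ k j, m k (v j) = (if b j = k then 1 else 0) - if b' j = k then 1 else 0) :
    (1 + Matrix.of fun k i : ν => m k (η i)).det = (-1) ^ ν.card := by
  let L := laplacian b b' ν f
  let N : Matrix ν ν K := .of fun k i => m k (η i)
  have hLN : L * N.transpose = -(L + L.transpose) := by
    ext k l
    have hedge : divergence b b' (fun j => f j * m l (v j)) k = L k l + L l k := by
      have hswap : L l k = laplacian b' b ν f k l := by rw [laplacian_swap hf]; rfl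
      have hsplit : ∀ j, f j * m l (v j) =
          (if b j = l then f j else 0) - if b' j = l then f j else 0 := fun j => by
        rw [hm, mul_sub, mul_ite, mul_ite, mul_one, mul_zero]
      rw [hswap]
      simp only [hsplit, L, laplacian, Matrix.of_apply, divergence, Finset.sum_sub_distrib]
      abel
    have hrow := congrArg (m l) (congrFun (laplacian_smul (b := b) (b' := b') (x := f) hη) k)
    have hzero := congrArg (m l) (hdiv k k.2)
    rw [Matrix.Module.smul_apply, map_sum] at hrow
    simp only [map_divergence, smul_add, divergence_add, map_add, map_smul, smul_eq_mul, map_zero,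
      hedge] at hrow hzero
    rw [Matrix.mul_apply, Matrix.neg_apply, Matrix.add_apply, Matrix.transpose_apply,
      ← add_eq_zero_iff_eq_neg', ← hzero, ← hrow]
    rfl
  have hmul : L * (1 + N.transpose) = -L.transpose := by
    rw [mul_add, mul_one, hLN]
    abel
  have hdet := congrArg Matrix.det hmul
  rw [Matrix.det_mul, Matrix.det_neg, Matrix.det_transpose, mul_comm, Fintype.card_coe] at hdet
  rw [← Matrix.det_transpose, Matrix.transpose_add, Matrix.transpose_one]
  exact mul_right_cancel₀ ((Matrix.isUnit_iff_isUnit_det _).1 hL).ne_zero hdet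

theorem IsFlowExchange.sum_smul_add_sub {x x' : ι → K} {h : V → K}
    (H : IsFlowExchange b b' ν x x' h) {v : ι → W} {η : V → W} {k : V}
    (hdiv : divergence b b' (fun j => (x j * h (b j)) • (v j + η (b j))) k = 0) :
    ∑ j with b' j = k, x' j • (v j + η (b j) - η (b' j)) = ∑ j with b j = k, x j • v j := by
  have hfac : ∀ (a : ι → V) (z : ι → K) (w : ι → W),
      h k • ∑ j with a j = k, z j • w j = ∑ j with a j = k, (z j * h (a j)) • w j :=
    fun a z w => by
      rw [Finset.smul_sum]
      exact Finset.sum_congr rfl fun j hj => by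
        rw [smul_smul, (Finset.mem_filter.1 hj).2, mul_comm]
  have hη : ∑ j with b' j = k, (x' j * h (b' j)) • η (b' j) =
      ∑ j with b j = k, (x j * h (b j)) • η (b j) := by
    rw [← hfac b' x' fun j => η (b' j), ← hfac b x fun j => η (b j)]
    congr 1
    calc ∑ j with b' j = k, x' j • η (b' j) = (∑ j with b' j = k, x' j) • η k := by
          rw [Finset.sum_smul]
          exact Finset.sum_congr rfl fun j hj => by rw [(Finset.mem_filter.1 hj).2]
      _ = ∑ j with b j = k, x j • η (b j) := by
          rw [H.sum_eq, Finset.sum_smul]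
          exact Finset.sum_congr rfl fun j hj => by rw [(Finset.mem_filter.1 hj).2]
  refine smul_right_injective W (H.potential_ne_zero k) ?_
  calc h k • ∑ j with b' j = k, x' j • (v j + η (b j) - η (b' j))
      = ∑ j with b' j = k, (x j * h (b j)) • (v j + η (b j)) -
          ∑ j with b j = k, (x j * h (b j)) • η (b j) := by
        rw [hfac, ← hη, ← Finset.sum_sub_distrib]
        simp only [smul_sub, H.flow_eq]
    _ = h k • ∑ j with b j = k, x j • v j := by
        rw [hfac, ← sub_eq_zero.1 hdiv, ← Finset.sum_sub_distrib]
        simp only [smul_add, add_sub_cancel_right]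

end Linearization

end Flows

/-! ### Function fields of tori -/

section PureTranscendence

variable {J k K : Type*} [Field k] [Field K] [Algebra k K]

theorem algebraicIndependent_of_adjoin_eq_top [Finite J] {u w : J → K}
    (hu : AlgebraicIndependent k u) (hw : IntermediateField.adjoin k (Set.range w) = ⊤) :
    AlgebraicIndependent k w := by
  have halg : Algebra.IsAlgebraic (Algebra.adjoin k (Set.range w)) K := by
    refine ⟨fun z => ?_⟩
    have hz : z ∈ IntermediateField.adjoin k (Set.range w) := hw ▸ IntermediateField.mem_top
    obtain ⟨r, hr, s, hs, rfl⟩ := IntermediateField.mem_adjoin_iff_div.1 hz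
    rw [div_eq_mul_inv]
    exact (isAlgebraic_algebraMap (⟨r, hr⟩ : Algebra.adjoin k (Set.range w))).mul
      (isAlgebraic_algebraMap (⟨s, hs⟩ : Algebra.adjoin k (Set.range w))).inv
  exact (Algebra.IsAlgebraic.isTranscendenceBasis_of_lift_le_trdeg_of_finite k w
    hu.lift_cardinalMk_le_trdeg).1

theorem exists_algEquiv_fractionRing {w : J → K} (hind : AlgebraicIndependent k w)
    (hw : IntermediateField.adjoin k (Set.range w) = ⊤) :
    ∃ α : FractionRing (MvPolynomial J k) ≃ₐ[k] K,
      ∀ j, α (algebraMap (MvPolynomial J k) _ (MvPolynomial.X j)) = w j := by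
  refine ⟨hind.aevalEquivField.trans
    ((IntermediateField.equivOfEq hw).trans IntermediateField.topEquiv), fun j => ?_⟩
  exact (hind.aevalEquivField_algebraMap_apply_coe (MvPolynomial.X j)).trans
    (MvPolynomial.aeval_X w j)

end PureTranscendence

namespace TorusFunctionField

variable {J : Type}

theorem algebraicIndependent_torusCoord :
    AlgebraicIndependent ℂ (torusCoord : J → TorusFunctionField J) := by
  let ι : MvPolynomial J ℂ →ₐ[ℂ] LaurentRing J := AddMonoidAlgebra.mapDomainAlgHom ℂ ℂ
    (Finsupp.mapRange.addMonoidHom (Nat.castAddMonoidHom ℤ) : (J →₀ ℕ) →+ (J →₀ ℤ))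
  have hι : Function.Injective ι := AddMonoidAlgebra.mapDomain_injective <|
    Finsupp.mapRange_injective _ Nat.cast_zero Nat.cast_injective
  have hX : ∀ j, ι (MvPolynomial.X j) = AddMonoidAlgebra.single (Finsupp.single j 1) 1 := fun j =>
    AddMonoidAlgebra.mapDomain_single.trans (by simp)
  have haeval : MvPolynomial.aeval (torusCoord : J → TorusFunctionField J) =
      (IsScalarTower.toAlgHom ℂ (LaurentRing J) (TorusFunctionField J)).comp ι := by
    ext j
    simp [hX, torusCoord]
  rw [AlgebraicIndependent, haeval]
  exact (IsFractionRing.injective _ _).comp hι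

theorem algebraMap_single_one (a : J →₀ ℤ) :
    algebraMap (LaurentRing J) (TorusFunctionField J) (AddMonoidAlgebra.single a 1) =
      a.prod fun j z => torusCoord j ^ z := by
  let χ : Multiplicative (J →₀ ℤ) →* TorusFunctionField J :=
    (algebraMap (LaurentRing J) (TorusFunctionField J)).toMonoidHom.comp
      (AddMonoidAlgebra.of ℂ (J →₀ ℤ))
  have hχ : ∀ j z, χ (Multiplicative.ofAdd (Finsupp.single j z)) = torusCoord j ^ z := by
    intro j z
    have hz : Finsupp.single j z = z • Finsupp.single j (1 : ℤ) := by simp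
    rw [hz, ofAdd_zsmul, map_zpow]
    rfl
  calc χ (Multiplicative.ofAdd a)
      = χ (Multiplicative.ofAdd (∑ j ∈ a.support, Finsupp.single j (a j))) :=
        congrArg (fun a => χ (Multiplicative.ofAdd a)) a.sum_single.symm
    _ = a.prod fun j z => torusCoord j ^ z := by
        rw [ofAdd_sum, map_prod]
        exact Finset.prod_congr rfl fun j _ => hχ j (a j)

theorem eq_top_of_torusCoord_mem {F : IntermediateField ℂ (TorusFunctionField J)}
    (hF : ∀ j, torusCoord j ∈ F) : F = ⊤ := by
  have hmem : ∀ p : LaurentRing J, algebraMap _ (TorusFunctionField J) p ∈ F := by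
    intro p
    induction p using AddMonoidAlgebra.induction_linear with
    | zero => exact (map_zero (algebraMap (LaurentRing J) (TorusFunctionField J))).symm ▸ zero_mem F
    | add p q hp hq =>
      exact (map_add (algebraMap (LaurentRing J) (TorusFunctionField J)) p q).symm ▸ add_mem hp hq
    | single a z =>
      have hsmul : algebraMap (LaurentRing J) (TorusFunctionField J)
          (AddMonoidAlgebra.single a z) = z • a.prod fun j t => torusCoord j ^ t := by
        rw [← algebraMap_single_one, Algebra.algebraMap_eq_smul_one,
          Algebra.algebraMap_eq_smul_one, ← smul_assoc, AddMonoidAlgebra.smul_single, smul_eq_mul,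
          mul_one]
      rw [hsmul]
      exact F.smul_mem (prod_mem fun j _ => zpow_mem (hF j) _)
  rw [eq_top_iff]
  intro z _
  obtain ⟨p, q, -, rfl⟩ := IsFractionRing.div_surjective (A := LaurentRing J) z
  exact div_mem (hmem p) (hmem q)

theorem exists_algEquiv {J' : Type} [Finite J'] (e : J' ≃ J) {w : J' → TorusFunctionField J}
    (hw : IntermediateField.adjoin ℂ (Set.range w) = ⊤) :
    ∃ ψ : TorusFunctionField J' ≃ₐ[ℂ] TorusFunctionField J, ∀ j, ψ (torusCoord j) = w j := by
  obtain ⟨α, hα⟩ := exists_algEquiv_fractionRing algebraicIndependent_torusCoord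
    (eq_top_of_torusCoord_mem fun j : J' => IntermediateField.subset_adjoin _ _ ⟨j, rfl⟩)
  obtain ⟨β, hβ⟩ := exists_algEquiv_fractionRing (algebraicIndependent_of_adjoin_eq_top
    (algebraicIndependent_torusCoord.comp e e.injective) hw) hw
  exact ⟨α.symm.trans β, fun j => by rw [← hα j, AlgEquiv.trans_apply, α.symm_apply_apply, hβ]⟩

section Positivity

open scoped ComplexOrder

/-- The value of a Laurent polynomial at the point `1` of the torus. -/
noncomputable def evalOne (J : Type) : LaurentRing J →ₐ[ℂ] ℂ := AddMonoidAlgebra.lift ℂ ℂ (J →₀ ℤ) 1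

theorem algebraMap_ne_zero_of_evalOne_pos {p : LaurentRing J} (hp : 0 < evalOne J p) :
    algebraMap (LaurentRing J) (TorusFunctionField J) p ≠ 0 := by
  refine (map_ne_zero_iff _ (IsFractionRing.injective _ _)).2 ?_
  rintro rfl
  exact hp.ne' (map_zero _)

/-- The positivity used for elimination on a torus: zero, and the quotients of Laurent polynomials
with positive values at the point `1`. -/
noncomputable def positiveCone (J : Type) : Subsemiring (TorusFunctionField J) where
  carrier := {z | z = 0 ∨ ∃ p q : LaurentRing J, 0 < evalOne J p ∧ 0 < evalOne J q ∧
    z = algebraMap _ _ p / algebraMap _ _ q}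
  zero_mem' := Or.inl rfl
  one_mem' := Or.inr ⟨1, 1, by simp, by simp, by simp⟩
  add_mem' := by
    rintro _ _ (rfl | ⟨p, q, hp, hq, rfl⟩) (rfl | ⟨p', q', hp', hq', rfl⟩)
    · exact Or.inl (add_zero 0)
    · exact Or.inr ⟨p', q', hp', hq', zero_add _⟩
    · exact Or.inr ⟨p, q, hp, hq, add_zero _⟩
    · refine Or.inr ⟨p * q' + q * p', q * q', ?_, ?_, ?_⟩
      · simpa only [map_add, map_mul] using add_pos (mul_pos hp hq') (mul_pos hq hp')
      · simpa only [map_mul] using mul_pos hq hq'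
      · rw [div_add_div _ _ (algebraMap_ne_zero_of_evalOne_pos hq)
          (algebraMap_ne_zero_of_evalOne_pos hq'), map_add, map_mul, map_mul, map_mul]
  mul_mem' := by
    rintro _ _ (rfl | ⟨p, q, hp, hq, rfl⟩) (rfl | ⟨p', q', hp', hq', rfl⟩)
    · exact Or.inl (mul_zero 0)
    · exact Or.inl (zero_mul _)
    · exact Or.inl (mul_zero _)
    · refine Or.inr ⟨p * p', q * q', ?_, ?_, ?_⟩
      · simpa only [map_mul] using mul_pos hp hp'
      · simpa only [map_mul] using mul_pos hq hq'
      · rw [div_mul_div_comm, map_mul, map_mul]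

theorem isPositiveCone_positiveCone : IsPositiveCone (positiveCone J) where
  inv_mem := by
    rintro _ (rfl | ⟨p, q, hp, hq, rfl⟩)
    · exact Or.inl inv_zero
    · exact Or.inr ⟨q, p, hq, hp, inv_div _ _⟩
  eq_zero_of_add_eq_zero := by
    rintro _ _ (rfl | ⟨p, q, hp, hq, rfl⟩) (rfl | ⟨p', q', hp', hq', rfl⟩) h
    · rfl
    · rfl
    · exact (add_zero _).symm.trans h
    · rw [div_add_div _ _ (algebraMap_ne_zero_of_evalOne_pos hq)
        (algebraMap_ne_zero_of_evalOne_pos hq'), ← map_mul, ← map_mul, ← map_mul, ← map_add] at h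
      refine absurd h (div_ne_zero (algebraMap_ne_zero_of_evalOne_pos ?_)
        (algebraMap_ne_zero_of_evalOne_pos ?_))
      · simpa only [map_add, map_mul] using add_pos (mul_pos hp hq') (mul_pos hq hp')
      · simpa only [map_mul] using mul_pos hq hq'

theorem torusCoord_mem_positiveCone (j : J) : torusCoord j ∈ positiveCone J :=
  Or.inr ⟨AddMonoidAlgebra.single (Finsupp.single j 1) 1, 1, by simp [evalOne], by simp,
    by simp [torusCoord]⟩

end Positivity

end TorusFunctionField

/-! ### Determinants and alternating maps -/

section AlternatingMaps

variable {ι ι' K W U Ω : Type*}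
  [CommRing K] [AddCommGroup W] [Module K W] [AddCommGroup U] [Module K U]
  [AddCommGroup Ω] [Module K Ω]

theorem alternatingMap_sum_smul [Fintype ι] [DecidableEq ι] (f : W [⋀^ι]→ₗ[K] U)
    (C : Matrix ι ι K) (v : ι → W) :
    f (fun i => ∑ j, C i j • v j) = C.det • f v := by
  let e := Pi.basisFun K ι
  let g := f.compLinearMap (Fintype.linearCombination K v)
  have hgv : g e = f v :=
    congrArg f <| funext fun i => by simp [e, Fintype.linearCombination_apply, Pi.single_apply]
  have hg : g = (LinearMap.toSpanSingleton K U (g e)).compAlternatingMap e.det := by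
    refine Module.Basis.ext_alternating e fun i hi => ?_
    let σ : Equiv.Perm ι := Equiv.ofBijective i (Finite.injective_iff_bijective.1 hi)
    change g (e ∘ σ) = LinearMap.toSpanSingleton K U (g e) (e.det (e ∘ σ))
    rw [AlternatingMap.map_perm, AlternatingMap.map_perm, Module.Basis.det_self]
    rcases Int.units_eq_one_or (Equiv.Perm.sign σ) with h | h <;> simp [h]
  calc f (fun i => ∑ j, C i j • v j) = g C := rfl
    _ = e.det C • g e := DFunLike.congr_fun hg C
    _ = C.det • f v := congrArg₂ _ (Pi.basisFun_det_apply C) hgv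

theorem alternatingMap_sumElim_of_eq_add [Fintype ι] [DecidableEq ι] [Fintype ι']
    (f : W [⋀^(ι ⊕ ι')]→ₗ[K] U) {u w : ι → W} {κ : ι' → W} {Q : Matrix ι ι K}
    {C : Matrix ι ι' K} (hw : ∀ i, w i = ∑ k, Q i k • u k + ∑ k, C i k • κ k) :
    f (Sum.elim w κ) = Q.det • f (Sum.elim u κ) := by
  classical
  have h := alternatingMap_sum_smul f (Matrix.fromBlocks Q C 0 1) (Sum.elim u κ)
  rw [Matrix.det_fromBlocks_zero₂₁, Matrix.det_one, mul_one] at h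
  rw [← h]
  congr 1
  funext i
  rcases i with i | i
  · simp [Fintype.sum_sum_type, hw i]
  · simp [Fintype.sum_sum_type, Matrix.one_apply]

theorem alternatingMap_sumElim_add_left [Finite ι] [Fintype ι'] (f : W [⋀^(ι ⊕ ι')]→ₗ[K] U)
    (u : ι → W) (κ : ι' → W) (C : Matrix ι ι' K) :
    f (Sum.elim (fun i => u i + ∑ k, C i k • κ k) κ) = f (Sum.elim u κ) := by
  classical
  cases nonempty_fintype ι
  rw [alternatingMap_sumElim_of_eq_add f (Q := 1) (u := u) (C := C) fun i => by
    simp [Matrix.one_apply], Matrix.det_one, one_smul]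

theorem alternatingMap_sumElim_add_right [Fintype ι] [Finite ι'] (f : W [⋀^(ι ⊕ ι')]→ₗ[K] U)
    (u : ι → W) (κ : ι' → W) (C : Matrix ι' ι K) :
    f (Sum.elim u fun i => κ i + ∑ k, C i k • u k) = f (Sum.elim u κ) := by
  have h := alternatingMap_sumElim_add_left (f.domDomCongr (Equiv.sumComm ι ι')) κ u C
  simpa only [AlternatingMap.domDomCongr_apply, Equiv.sumComm_apply, Sum.elim_swap] using h

theorem det_smul_map_of_map_eq_zero [Fintype ι] [DecidableEq ι] [Fintype ι'] [DecidableEq ι']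
    (b : Module.Basis (ι ⊕ ι') K W) (f : Ω [⋀^ι]→ₗ[K] U)
    (π : W →ₗ[K] Ω) {u : ι → W} (w : ι → W) {κ : ι' → W} (hκ : ∀ i, π (κ i) = 0)
    (hu : IsUnit (b.det (Sum.elim u κ))) :
    b.det (Sum.elim u κ) • f (fun i => π (w i)) = b.det (Sum.elim w κ) • f (fun i => π (u i)) := by
  obtain ⟨hli, hsp⟩ := (Module.Basis.is_basis_iff_det b).2 hu
  let B : Module.Basis (ι ⊕ ι') K W := Module.Basis.mk hli hsp.ge
  let Q : Matrix ι ι K := Matrix.of fun i k => B.repr (w i) (Sum.inl k)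
  let C : Matrix ι ι' K := Matrix.of fun i k => B.repr (w i) (Sum.inr k)
  have hw : ∀ i, w i = ∑ k, Q i k • u k + ∑ k, C i k • κ k := by
    intro i
    conv_lhs => rw [← B.sum_repr (w i)]
    simp [Fintype.sum_sum_type, B, Q, C]
  have hπw : ∀ i, π (w i) = ∑ k, Q i k • π (u k) := fun i => by simp [hw i, hκ]
  simp_rw [hπw]
  rw [alternatingMap_sumElim_of_eq_add b.det hw, alternatingMap_sum_smul f Q, smul_smul,
    smul_eq_mul, mul_comm]

end AlternatingMaps

/-! ### Logarithmic differentials -/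

/-- The logarithmic differential `dx / x`. -/
noncomputable def dlog {K : Type*} [Field K] [Algebra ℂ K] (x : K) : Ω[K⁄ℂ] :=
  x⁻¹ • KaehlerDifferential.D ℂ K x

section LogarithmicDifferential

variable {K : Type*} [Field K] [Algebra ℂ K]

theorem smul_dlog {x : K} (hx : x ≠ 0) : x • dlog x = KaehlerDifferential.D ℂ K x :=
  smul_inv_smul₀ hx _

theorem dlog_one : dlog (1 : K) = 0 := by simp [dlog]

theorem dlog_mul {x y : K} (hx : x ≠ 0) (hy : y ≠ 0) : dlog (x * y) = dlog x + dlog y := by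
  rw [dlog, Derivation.leibniz, smul_add, smul_smul, smul_smul, add_comm, dlog, dlog]
  congr 2 <;> field_simp

theorem dlog_inv (x : K) : dlog x⁻¹ = -dlog x := by
  rcases eq_or_ne x 0 with rfl | hx
  · simp [dlog]
  · rw [dlog, Derivation.leibniz_inv, dlog, smul_smul, ← neg_smul]
    congr 1
    field_simp

theorem dlog_div {x y : K} (hx : x ≠ 0) (hy : y ≠ 0) : dlog (x / y) = dlog x - dlog y := by
  rw [div_eq_mul_inv, dlog_mul hx (inv_ne_zero hy), dlog_inv, sub_eq_add_neg]

theorem dlog_zpow {x : K} (hx : x ≠ 0) (l : ℤ) : dlog (x ^ l) = l • dlog x := by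
  rw [dlog, Derivation.leibniz_zpow, dlog, smul_comm, smul_smul]
  congr 2
  have := zpow_ne_zero l hx
  rw [zpow_sub_one₀ hx]
  field_simp

theorem dlog_prod {ι : Type*} (s : Finset ι) {x : ι → K} (hx : ∀ i ∈ s, x i ≠ 0) :
    dlog (∏ i ∈ s, x i) = ∑ i ∈ s, dlog (x i) := by
  classical
  induction s using Finset.induction_on with
  | empty => exact dlog_one
  | insert a s ha ih =>
    have hs : ∀ i ∈ s, x i ≠ 0 := fun i hi => hx i (Finset.mem_insert_of_mem hi)
    rw [Finset.prod_insert ha, Finset.sum_insert ha, dlog_mul (hx a (Finset.mem_insert_self a s))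
      (Finset.prod_ne_zero_iff.2 hs), ih hs]

end LogarithmicDifferential

/-! ### Rays, divisor classes and points of the dual torus -/

theorem exists_linearMap_of_forall_sum_eq_zero {ι A N M : Type*} [Fintype ι] [CommRing A]
    [AddCommGroup N] [Module A N] [AddCommGroup M] [Module A M] {v : ι → N}
    (hv : Submodule.span A (Set.range v) = ⊤) {w : ι → M}
    (hw : ∀ l : ι → A, ∑ j, l j • v j = 0 → ∑ j, l j • w j = 0) :
    ∃ φ : N →ₗ[A] M, ∀ j, φ (v j) = w j := by
  classical
  have hsurj : LinearMap.range (Fintype.linearCombination A v) = ⊤ :=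
    (Fintype.range_linearCombination A v).trans hv
  let e := (Fintype.linearCombination A v).quotKerEquivOfSurjective (LinearMap.range_eq_top.1 hsurj)
  let ψ := (LinearMap.ker (Fintype.linearCombination A v)).liftQ
    (Fintype.linearCombination A w) fun l hl => hw l hl
  refine ⟨ψ ∘ₗ e.symm.toLinearMap, fun j => ?_⟩
  have he : e (Submodule.Quotient.mk (Pi.single j 1)) = v j :=
    (LinearMap.quotKerEquivOfSurjective_apply_mk ..).trans (by simp)
  rw [LinearMap.comp_apply, LinearEquiv.coe_coe, ← he, LinearEquiv.symm_apply_apply]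
  exact (Submodule.liftQ_apply ..).trans (by simp)

theorem exists_linearMap_intCast {ι : Type*} [Finite ι] {K M : Type*} [CommRing K]
    [AddCommGroup M] [Module K M] (m : (ι → ℤ) →ₗ[ℤ] M) :
    ∃ μ : (ι → K) →ₗ[K] M, ∀ v : ι → ℤ, μ (fun a => (v a : K)) = m v := by
  classical
  have := Fintype.ofFinite ι
  refine ⟨Fintype.linearCombination K fun a => m (Pi.single a 1), fun v => ?_⟩
  calc ∑ a, (v a : K) • m (Pi.single a 1) = ∑ a, m (Pi.single a (v a)) :=
        Finset.sum_congr rfl fun a _ => by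
          rw [Int.cast_smul_eq_zsmul, ← map_smul, ← Pi.single_smul, smul_eq_mul, mul_one]
    _ = m v := by rw [← map_sum, Finset.univ_sum_single]

namespace SmoothCompleteFan

variable {n R : ℕ} (Y : SmoothCompleteFan n R)

theorem span_range_ray : Submodule.span ℤ (Set.range Y.ray) = ⊤ := by
  obtain ⟨σ, hσ, -⟩ := Y.complete 0
  rw [eq_top_iff, ← Y.span_eq_top σ hσ]
  exact Submodule.span_mono (Set.range_comp_subset_range Subtype.val Y.ray)

theorem apply_ray_eq_zero_of_nonneg {m : Module.Dual ℤ (Fin n → ℤ)}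
    (hm : ∀ j, 0 ≤ m (Y.ray j)) (j : Fin R) : m (Y.ray j) = 0 := by
  obtain ⟨μ, hμ⟩ := exists_linearMap_intCast (K := ℝ) ((Algebra.linearMap ℤ ℝ) ∘ₗ m)
  obtain ⟨σ, -, hσ⟩ := Y.complete (-fun a => (Y.ray j a : ℝ))
  have hle : ∀ z ∈ PointedCone.hull ℝ ((fun j a => (Y.ray j a : ℝ)) '' (σ : Set (Fin R))),
      0 ≤ μ z := fun z hz => by
    induction hz using Submodule.span_induction with
    | mem z hz =>
      obtain ⟨k, -, rfl⟩ := hz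
      exact (hμ _).symm ▸ Int.cast_nonneg (hm k)
    | zero => exact (map_zero μ).ge
    | add a b _ _ ha hb => exact (map_add μ a b).symm ▸ add_nonneg ha hb
    | smul r a _ ha => exact (map_smul μ (r : ℝ) a).symm ▸ mul_nonneg r.2 ha
  have hneg := hle _ hσ
  rw [map_neg, hμ, Left.nonneg_neg_iff] at hneg
  exact le_antisymm (Int.cast_nonpos.1 hneg) (hm j)

theorem exists_dual_of_divClass_eq {a b : Fin R → ℤ} (h : Y.divClass a = Y.divClass b) :
    ∃ m : Module.Dual ℤ (Fin n → ℤ), ∀ j, m (Y.ray j) = a j - b j := by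
  obtain ⟨m, hm⟩ := (Submodule.Quotient.eq _).1 h
  exact ⟨m, congrFun hm⟩

theorem divClass_eq_sum (a : Fin R → ℤ) : Y.divClass a = ∑ j, a j • Y.D j := by
  simp only [D, ← map_smul, ← map_sum, ← Pi.single_smul, smul_eq_mul, mul_one,
    Finset.univ_sum_single]

theorem exists_dual_D_eq {l : Fin R → ℤ} (hl : ∑ j, l j • Y.ray j = 0) :
    ∃ μ : Module.Dual ℤ Y.Pic, ∀ j, μ (Y.D j) = l j := by
  have hker : LinearMap.range Y.rhoDual ≤ LinearMap.ker (Fintype.linearCombination ℤ l) := by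
    rintro _ ⟨m, rfl⟩
    have hml := congrArg m hl
    simp only [map_sum, map_smul, map_zero] at hml
    simpa [SmoothCompleteFan.rhoDual, Fintype.linearCombination_apply, mul_comm] using hml
  refine ⟨(LinearMap.range Y.rhoDual).liftQ _ hker, fun j => ?_⟩
  exact (Submodule.liftQ_apply ..).trans (by simp)

theorem sum_dual_D_smul_ray (μ : Module.Dual ℤ Y.Pic) : ∑ j, μ (Y.D j) • Y.ray j = 0 := by
  refine (Module.forall_dual_apply_eq_zero_iff ℤ _).1 fun m => ?_
  have hm : Y.divClass (Y.rhoDual m) = 0 :=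
    (Submodule.Quotient.mk_eq_zero _).2 (LinearMap.mem_range_self _ m)
  calc m (∑ j, μ (Y.D j) • Y.ray j) = μ (Y.divClass (Y.rhoDual m)) := by
        rw [divClass_eq_sum, map_sum, map_sum]
        refine Finset.sum_congr rfl fun j _ => ?_
        rw [map_smul, map_smul, smul_eq_mul, smul_eq_mul, mul_comm]
        rfl
    _ = 0 := by rw [hm, map_zero]

/-- The points of the torus dual to `Y` over a field `K`, given by the values of the monomials
`z^{v_j}`. -/
structure IsDualPoint {K : Type*} [Field K] (x : Fin R → K) : Prop where
  ne_zero : ∀ j, x j ≠ 0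
  relation : ∀ l : Fin R → ℤ, ∑ j, l j • Y.ray j = 0 → ∏ j, x j ^ l j = 1

theorem IsDualPoint.eq_prod_compl_zpow {Y : SmoothCompleteFan n R} {K : Type*} [Field K]
    {x : Fin R → K} (hx : Y.IsDualPoint x) {E : Finset (Fin R)} {b : Fin R} (hb : b ∈ E)
    {l : Fin R → ℤ} (hl : ∑ j, l j • Y.ray j = 0) (hlb : l b = 1)
    (hlE : ∀ b' ∈ E, b' ≠ b → l b' = 0) : x b = ∏ k ∈ Eᶜ, x k ^ (-l k) := by
  have hprod := hx.relation l hl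
  rw [← Finset.prod_mul_prod_compl E, Finset.prod_eq_single_of_mem b hb fun b' hb' h => by
    rw [hlE b' hb' h, zpow_zero], hlb, zpow_one] at hprod
  simpa only [zpow_neg, Finset.prod_inv_distrib] using eq_inv_of_mul_eq_one_left hprod

/-- The ray generators as vectors over `K`. -/
def rayOver (K : Type*) [Field K] (j : Fin R) : Fin n → K := fun a => (Y.ray j a : K)

theorem IsDualPoint.exists_dlog {Y : SmoothCompleteFan n R} {K : Type*} [Field K] [Algebra ℂ K]
    {x : Fin R → K} (hx : Y.IsDualPoint x) :
    ∃ π : (Fin n → K) →ₗ[K] Ω[K⁄ℂ], ∀ j, π (Y.rayOver K j) = dlog (x j) := by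
  have hdlog : ∀ l : Fin R → ℤ, ∑ j, l j • Y.ray j = 0 → ∑ j, l j • dlog (x j) = 0 := by
    intro l hl
    have h := congrArg dlog (hx.relation l hl)
    rw [dlog_prod _ fun j _ => zpow_ne_zero _ (hx.ne_zero j), dlog_one] at h
    simpa only [dlog_zpow (hx.ne_zero _)] using h
  obtain ⟨φ, hφ⟩ := exists_linearMap_of_forall_sum_eq_zero Y.span_range_ray hdlog
  obtain ⟨π, hπ⟩ := exists_linearMap_intCast (K := K) φ
  exact ⟨π, fun j => (hπ _).trans (hφ j)⟩

end SmoothCompleteFan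

/-! ### Two nef partitions of the same classes -/

namespace NefPartition

variable {n R c : ℕ} {Y : SmoothCompleteFan n R} {L : Fin c → Y.Pic} (P P' : NefPartition Y L)

/-- The index of the set of the partition that contains a ray. -/
noncomputable def blockIndex (j : Fin R) : Fin (c + 1) := (P.existsUnique_mem j).choose

theorem mem_S_iff (j : Fin R) (i : Fin (c + 1)) : j ∈ P.S i ↔ P.blockIndex j = i :=
  ⟨(P.existsUnique_mem j).unique (P.existsUnique_mem j).choose_spec.1,
    fun h => h ▸ (P.existsUnique_mem j).choose_spec.1⟩

theorem S_eq_filter (i : Fin (c + 1)) : P.S i = Finset.univ.filter (P.blockIndex · = i) :=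
  Finset.ext fun j => by rw [P.mem_S_iff, Finset.mem_filter_univ]

theorem divClass_indicator (i : Fin c) :
    Y.divClass (fun j => if P.blockIndex j = i.castSucc then 1 else 0) = L i := by
  rw [Y.divClass_eq_sum, ← P.sum_eq, P.S_eq_filter, Finset.sum_filter]
  simp only [ite_smul, one_smul, zero_smul]

/-- The index `c + 1` needs a separate argument: the two sets have linearly equivalent divisors
because both complements do. -/
theorem exists_dual_blockIndex (i : Fin (c + 1)) : ∃ m : Module.Dual ℤ (Fin n → ℤ), ∀ j,
    m (Y.ray j) = (if P.blockIndex j = i then 1 else 0) - if P'.blockIndex j = i then 1 else 0 := by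
  have hc (i : Fin c) :=
    Y.exists_dual_of_divClass_eq ((P.divClass_indicator i).trans (P'.divClass_indicator i).symm)
  induction i using Fin.lastCases with
  | cast i => exact hc i
  | last =>
    choose m hm using hc
    have hlast (k : Fin (c + 1)) : (if k = Fin.last c then (1 : ℤ) else 0) =
        1 - ∑ i : Fin c, if k = i.castSucc then 1 else 0 := by
      rw [eq_sub_iff_add_eq', ← Fin.sum_univ_castSucc fun i => if k = i then (1 : ℤ) else 0,
        Fintype.sum_ite_eq]
    refine ⟨-∑ i, m i, fun j => ?_⟩
    simp only [LinearMap.neg_apply, LinearMap.sum_apply, hm, Finset.sum_sub_distrib, hlast]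
    ring

theorem isBalanced_blockIndex : IsBalanced P.blockIndex P'.blockIndex := by
  classical
  intro I hI j hj
  choose m hm using P'.exists_dual_blockIndex P
  have hsum (j : Fin R) : (∑ i ∈ I, m i) (Y.ray j) =
      (if P'.blockIndex j ∈ I then 1 else 0) - if P.blockIndex j ∈ I then 1 else 0 := by
    simp only [LinearMap.sum_apply, hm, Finset.sum_sub_distrib, Finset.sum_ite_eq]
  have hnonneg (j : Fin R) : 0 ≤ (∑ i ∈ I, m i) (Y.ray j) := by
    rw [hsum, sub_nonneg]
    by_cases h : P.blockIndex j ∈ I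
    · rw [if_pos h, if_pos (hI j h)]
    · rw [if_neg h]
      exact ite_nonneg zero_le_one le_rfl
  have hzero := (hsum j).symm.trans (Y.apply_ray_eq_zero_of_nonneg hnonneg j)
  by_contra h
  simp [hj, h] at hzero

theorem divergence_blockIndex_eq_zero {l : Fin R → ℤ} (hl : ∑ j, l j • Y.ray j = 0)
    (k : Fin (c + 1)) : divergence P.blockIndex P'.blockIndex l k = 0 := by
  obtain ⟨m, hm⟩ := P.exists_dual_blockIndex P' k
  have h := congrArg m hl
  simpa only [divergence, map_sum, map_smul, map_zero, hm, smul_eq_mul, mul_sub, mul_ite, mul_one,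
    mul_zero, Finset.sum_sub_distrib, ← Finset.sum_filter] using h

theorem exists_dual_rayOver (K : Type*) [Field K] (k : Fin (c + 1)) :
    ∃ m : Module.Dual K (Fin n → K), ∀ j, m (Y.rayOver K j) =
      (if P.blockIndex j = k then 1 else 0) - if P'.blockIndex j = k then 1 else 0 := by
  obtain ⟨m, hm⟩ := P.exists_dual_blockIndex P' k
  obtain ⟨μ, hμ⟩ := exists_linearMap_intCast (K := K) (Algebra.linearMap ℤ K ∘ₗ m)
  refine ⟨μ, fun j => (hμ _).trans ?_⟩
  simp [hm]

end NefPartition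

/-! ### The lattice data of the Przyjalkowski method -/

namespace PrzyjalkowskiChoice

variable {n R c : ℕ} {Y : SmoothCompleteFan n R} {L : Fin c → Y.Pic} {P : NefPartition Y L}
  (d : PrzyjalkowskiChoice P)

theorem blockIndex_s (i : Fin c) : P.blockIndex (d.s i) = i.castSucc :=
  (P.mem_S_iff _ _).1 (d.s_mem i)

theorem notMem_E_of_mem {i : Fin c} {j : Fin R} (hj : j ∈ P.S i.castSucc) : j ∉ d.E := fun h =>
  (Fin.castSucc_lt_last i).ne ((P.existsUnique_mem j).unique hj (d.E_subset h))

theorem relation_eq_zero {l : Fin R → ℤ} (hl : ∑ j, l j • Y.ray j = 0) (hE : ∀ b ∈ d.E, l b = 0) :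
    l = 0 := by
  obtain ⟨μ, hμ⟩ := Y.exists_dual_D_eq hl
  have hμ0 : μ = 0 := LinearMap.ext_on_range d.span_eq_top fun b => (hμ b).trans (hE b b.2)
  exact funext fun j => (hμ j).symm.trans (by rw [hμ0, LinearMap.zero_apply, Pi.zero_apply])

theorem exists_relation {b : Fin R} (hb : b ∈ d.E) : ∃ l : Fin R → ℤ,
    ∑ j, l j • Y.ray j = 0 ∧ l b = 1 ∧ ∀ b' ∈ d.E, b' ≠ b → l b' = 0 := by
  let B : Module.Basis d.E ℤ Y.Pic := .mk d.linearIndependent d.span_eq_top.ge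
  have hB (k : d.E) : B.coord ⟨b, hb⟩ (Y.D k) = if (k : Fin R) = b then 1 else 0 := by
    rw [← Module.Basis.mk_apply d.linearIndependent d.span_eq_top.ge k, Module.Basis.coord_apply,
      Module.Basis.repr_self, Finsupp.single_apply]
    simp only [Subtype.ext_iff]
  exact ⟨fun j => B.coord ⟨b, hb⟩ (Y.D j), Y.sum_dual_D_smul_ray _,
    (hB ⟨b, hb⟩).trans (if_pos rfl), fun b' hb' h => (hB ⟨b', hb'⟩).trans (if_neg h)⟩

/-- The rays outside `E`, indexed by the variables and the elements `s_i`. -/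
def freeRay : d.Var ⊕ Fin c → Fin R := Sum.elim Subtype.val d.s

theorem freeRay_injective : Function.Injective d.freeRay := by
  refine Subtype.val_injective.sumElim (fun i i' h => ?_) fun j i => j.2.2 i
  exact Fin.castSucc_injective _ ((d.blockIndex_s i).symm.trans (h ▸ d.blockIndex_s i'))

theorem mem_range_freeRay {j : Fin R} : j ∈ Set.range d.freeRay ↔ j ∉ d.E := by
  constructor
  · rintro ⟨k | i, rfl⟩
    exacts [k.2.1, d.notMem_E_of_mem (d.s_mem i)]
  · intro hj
    by_cases h : ∀ i, j ≠ d.s i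
    · exact ⟨Sum.inl ⟨j, hj, h⟩, rfl⟩
    · obtain ⟨i, hi⟩ := not_forall_not.1 h
      exact ⟨Sum.inr i, hi.symm⟩

theorem linearIndependent_ray_freeRay : LinearIndependent ℤ (Y.ray ∘ d.freeRay) := by
  have hE : LinearIndepOn ℤ Y.ray (Set.range d.freeRay) := by
    refine linearIndepOn_iff.2 fun l hl hsum => DFunLike.coe_injective ?_
    rw [Finsupp.linearCombination_apply,
      Finsupp.sum_fintype l (fun j a => a • Y.ray j) fun _ => zero_smul ℤ _] at hsum
    refine d.relation_eq_zero hsum fun b hb => ?_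
    exact (Finsupp.mem_supported' ℤ l).1 hl b fun h => d.mem_range_freeRay.1 h hb
  exact hE.comp (fun k => ⟨d.freeRay k, Set.mem_range_self k⟩)
    fun k k' h => d.freeRay_injective (congrArg Subtype.val h)

theorem span_range_ray_freeRay : Submodule.span ℤ (Set.range (Y.ray ∘ d.freeRay)) = ⊤ := by
  have hfree {j : Fin R} (hj : j ∉ d.E) :
      Y.ray j ∈ Submodule.span ℤ (Set.range (Y.ray ∘ d.freeRay)) := by
    obtain ⟨k, rfl⟩ := d.mem_range_freeRay.2 hj
    exact Submodule.subset_span ⟨k, rfl⟩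
  rw [eq_top_iff, ← Y.span_range_ray, Submodule.span_le]
  rintro _ ⟨j, rfl⟩
  by_cases hj : j ∈ d.E
  · obtain ⟨l, hl, hlj, hlE⟩ := d.exists_relation hj
    rw [← Finset.sum_add_sum_compl d.E, Finset.sum_eq_single_of_mem j hj fun b hb h => by
      rw [hlE b hb h, zero_smul], hlj, one_smul] at hl
    rw [eq_neg_of_add_eq_zero_left hl]
    exact neg_mem (sum_mem fun k hk => zsmul_mem (hfree (Finset.mem_compl.1 hk)) _)
  · exact hfree hj

theorem card_var_add : Nat.card d.Var + c = n := by
  have h := Module.finrank_eq_nat_card_basis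
    (Module.Basis.mk d.linearIndependent_ray_freeRay d.span_range_ray_freeRay.ge)
  rw [Module.finrank_fin_fun, Nat.card_sum, Nat.card_fin] at h
  exact h.symm

theorem det_rayOver_sq {ι : Type*} [Fintype ι] [DecidableEq ι] (K : Type*) [Field K]
    (e : ι ≃ d.Var) (τ : Fin n ≃ ι ⊕ Fin c) :
    ((Pi.basisFun K (Fin n)).reindex τ).det
      (Sum.elim (fun k => Y.rayOver K (e k)) fun i => Y.rayOver K (d.s i)) ^ 2 = 1 := by
  let ρ : ι ⊕ Fin c → Fin n → ℤ := Y.ray ∘ d.freeRay ∘ e.sumCongr (.refl _)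
  have hunit : IsUnit (((Pi.basisFun ℤ (Fin n)).reindex τ).det ρ) := by
    refine (Module.Basis.is_basis_iff_det _).1
      ⟨d.linearIndependent_ray_freeRay.comp _ (e.sumCongr (.refl _)).injective, ?_⟩
    rw [← d.span_range_ray_freeRay]
    exact congrArg _ ((e.sumCongr (.refl _)).surjective.range_comp (Y.ray ∘ d.freeRay))
  have hcast : ((Pi.basisFun K (Fin n)).reindex τ).det
      (Sum.elim (fun k => Y.rayOver K (e k)) fun i => Y.rayOver K (d.s i)) =
      (((Pi.basisFun ℤ (Fin n)).reindex τ).det ρ : ℤ) := by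
    rw [Module.Basis.det_apply, Module.Basis.det_apply, Int.cast_det]
    congr 1
    ext i (k | k) <;>
      simp [Module.Basis.toMatrix_apply, ρ, freeRay, SmoothCompleteFan.rayOver]
  rw [hcast, ← Int.cast_pow, Int.isUnit_sq hunit, Int.cast_one]

end PrzyjalkowskiChoice

/-! ### The coordinates of the Przyjalkowski method -/

namespace NefPartition

variable {n R c : ℕ} {Y : SmoothCompleteFan n R} {L : Fin c → Y.Pic} {P P' : NefPartition Y L}

/-- The points over `K` of the mirror of `X`, the subvariety `∑_{j ∈ S_i} x_j = 1`, `i ≤ c`, of the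
torus dual to `Y`. -/
structure IsMirrorPoint (P : NefPartition Y L) {K : Type*} [Field K] (x : Fin R → K) : Prop
    extends Y.IsDualPoint x where
  sum_eq_one : ∀ i : Fin c, ∑ j ∈ P.S i.castSucc, x j = 1

theorem IsMirrorPoint.of_isFlowExchange {K : Type*} [Field K] {ν : Finset (Fin (c + 1))}
    {x x' : Fin R → K} {h : Fin (c + 1) → K} (hx : P.IsMirrorPoint x)
    (H : IsFlowExchange P.blockIndex P'.blockIndex ν x x' h) : P'.IsMirrorPoint x' where
  ne_zero j hj := H.flow_ne_zero (hx.ne_zero j) ((H.flow_eq j).trans (by rw [hj, zero_mul]))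
  relation l hl := (H.prod_zpow_eq (P.divergence_blockIndex_eq_zero P' hl)).trans (hx.relation l hl)
  sum_eq_one i := by rw [P'.S_eq_filter, H.sum_eq, ← P.S_eq_filter, hx.sum_eq_one]

end NefPartition

namespace PrzyjalkowskiChoice

variable {n R c : ℕ} {Y : SmoothCompleteFan n R} {L : Fin c → Y.Pic} {P : NefPartition Y L}
  (d : PrzyjalkowskiChoice P) {K : Type*} [Field K]

/-- The coordinate by which the coordinates of a block are divided: `x_{s_i}` for the block `S_i`
with `i ≤ c`, and `1` for the block `S_{c+1}`. -/
noncomputable def scale (x : Fin R → K) : Fin (c + 1) → K :=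
  Fin.snoc (α := fun _ => K) (fun i => x (d.s i)) 1

/-- The coordinates `x_j / x_{s_i}` for `j ∈ S_i`, `i ≤ c`, and `x_j` for `j ∈ S_{c+1}`. On the
substitution of the Przyjalkowski method they restrict to the variables `y_j`. -/
noncomputable def quot (x : Fin R → K) (j : Fin R) : K := x j / d.scale x (P.blockIndex j)

theorem scale_castSucc (x : Fin R → K) (i : Fin c) : d.scale x i.castSucc = x (d.s i) :=
  Fin.snoc_castSucc ..

theorem scale_last (x : Fin R → K) : d.scale x (Fin.last c) = 1 :=
  Fin.snoc_last ..

theorem scale_ne_zero {x : Fin R → K} (hx : ∀ j, x j ≠ 0) (k : Fin (c + 1)) : d.scale x k ≠ 0 := by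
  induction k using Fin.lastCases with
  | last => exact (d.scale_last x).symm ▸ one_ne_zero
  | cast i => exact (d.scale_castSucc x i).symm ▸ hx _

theorem quot_mul_scale {x : Fin R → K} (hx : ∀ j, x j ≠ 0) (j : Fin R) :
    d.quot x j * d.scale x (P.blockIndex j) = x j :=
  div_mul_cancel₀ _ (d.scale_ne_zero hx _)

theorem quot_s {x : Fin R → K} (hx : ∀ j, x j ≠ 0) (i : Fin c) : d.quot x (d.s i) = 1 := by
  rw [quot, d.blockIndex_s, d.scale_castSucc, div_self (hx _)]

theorem sum_quot {x : Fin R → K} (hx : P.IsMirrorPoint x) (i : Fin c) :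
    ∑ j ∈ P.S i.castSucc, d.quot x j = (x (d.s i))⁻¹ := by
  calc ∑ j ∈ P.S i.castSucc, d.quot x j = ∑ j ∈ P.S i.castSucc, x j / x (d.s i) :=
        Finset.sum_congr rfl fun j hj => by
          rw [quot, (P.mem_S_iff _ _).1 hj, d.scale_castSucc]
    _ = (x (d.s i))⁻¹ := by rw [← Finset.sum_div, hx.sum_eq_one, one_div]

theorem mem_of_quot_mem {x : Fin R → K} (hx : P.IsMirrorPoint x) {F : Subfield K}
    (hF : ∀ j : d.Var, d.quot x j ∈ F) (j : Fin R) : x j ∈ F := by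
  have hquot {j : Fin R} (hj : j ∉ d.E) : d.quot x j ∈ F := by
    obtain ⟨k | i, rfl⟩ := d.mem_range_freeRay.2 hj
    exacts [hF k, (d.quot_s hx.ne_zero i).symm ▸ one_mem F]
  have hscale (k : Fin (c + 1)) : d.scale x k ∈ F := by
    induction k using Fin.lastCases with
    | last => exact (d.scale_last x).symm ▸ one_mem F
    | cast i =>
      rw [d.scale_castSucc, ← inv_inv (x _), ← d.sum_quot hx]
      exact inv_mem (sum_mem fun j hj => hquot (d.notMem_E_of_mem hj))
  have hfree {j : Fin R} (hj : j ∉ d.E) : x j ∈ F :=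
    d.quot_mul_scale hx.ne_zero j ▸ mul_mem (hquot hj) (hscale _)
  by_cases hj : j ∈ d.E
  · obtain ⟨l, hl, hlj, hlE⟩ := d.exists_relation hj
    rw [hx.eq_prod_compl_zpow hj hl hlj hlE]
    exact prod_mem fun k hk => zpow_mem (hfree (Finset.mem_compl.1 hk)) _
  · exact hfree hj

theorem map_eq_of_map_quot_eq {K' F : Type*} [Field K'] [FunLike F K K'] [RingHomClass F K K']
    {x : Fin R → K} (hx : P.IsMirrorPoint x) {z : Fin R → K'} (hz : P.IsMirrorPoint z) (φ : F)
    (hφ : ∀ j : d.Var, φ (d.quot x j) = d.quot z j) (j : Fin R) : φ (x j) = z j := by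
  have hquot {j : Fin R} (hj : j ∉ d.E) : φ (d.quot x j) = d.quot z j := by
    obtain ⟨k | i, rfl⟩ := d.mem_range_freeRay.2 hj
    · exact hφ k
    · exact (congrArg φ (d.quot_s hx.ne_zero i)).trans
        ((map_one φ).trans (d.quot_s hz.ne_zero i).symm)
  have hscale (k : Fin (c + 1)) : φ (d.scale x k) = d.scale z k := by
    induction k using Fin.lastCases with
    | last => rw [scale_last, scale_last, map_one]
    | cast i =>
      rw [scale_castSucc, scale_castSucc, ← inv_inj, ← map_inv₀, ← d.sum_quot hx, ← d.sum_quot hz,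
        map_sum]
      exact Finset.sum_congr rfl fun j hj => hquot (d.notMem_E_of_mem hj)
  have hfree {j : Fin R} (hj : j ∉ d.E) : φ (x j) = z j := by
    rw [← d.quot_mul_scale hx.ne_zero, map_mul, hquot hj, hscale, d.quot_mul_scale hz.ne_zero]
  by_cases hj : j ∈ d.E
  · obtain ⟨l, hl, hlj, hlE⟩ := d.exists_relation hj
    rw [hx.eq_prod_compl_zpow hj hl hlj hlE, hz.eq_prod_compl_zpow hj hl hlj hlE, map_prod]
    exact Finset.prod_congr rfl fun k hk => by rw [map_zpow₀, hfree (Finset.mem_compl.1 hk)]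
  · exact hfree hj

section Substitution

variable {d} {x : Fin R → TorusFunctionField d.Var}

theorem IsSubstitution.isMirrorPoint (hx : d.IsSubstitution x) : P.IsMirrorPoint x where
  ne_zero := hx.ne_zero
  relation := hx.relation
  sum_eq_one i := by
    rw [Finset.sum_congr rfl (hx.block i), ← Finset.sum_div]
    exact div_self (d.sum_y_ne_zero _ ⟨_, d.s_mem i⟩)

theorem IsSubstitution.quot_eq_torusCoord (hx : d.IsSubstitution x) (j : d.Var) :
    d.quot x j = torusCoord j := by
  have hy : d.y j = torusCoord j := dif_pos j.2
  rw [quot, ← hy]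
  induction h : P.blockIndex j using Fin.lastCases with
  | last => rw [d.scale_last, div_one, hx.free j ((P.mem_S_iff _ _).2 h) j.2.1]
  | cast i =>
    have hys : d.y (d.s i) = 1 := dif_neg fun h => h.2 i rfl
    rw [d.scale_castSucc, hx.block i j ((P.mem_S_iff _ _).2 h), hx.block i _ (d.s_mem i), hys,
      div_div_div_cancel_right₀ (d.sum_y_ne_zero _ ⟨_, d.s_mem i⟩), div_one]

theorem IsSubstitution.mem_positiveCone (hx : d.IsSubstitution x) (j : Fin R) :
    x j ∈ TorusFunctionField.positiveCone d.Var := by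
  have hS := TorusFunctionField.isPositiveCone_positiveCone (J := d.Var)
  have hy (j : Fin R) : d.y j ∈ TorusFunctionField.positiveCone d.Var := by
    rw [y]
    split_ifs
    exacts [TorusFunctionField.torusCoord_mem_positiveCone _, one_mem _]
  have hfree {j : Fin R} (hj : j ∉ d.E) : x j ∈ TorusFunctionField.positiveCone d.Var := by
    obtain ⟨k, hk, -⟩ := P.existsUnique_mem j
    induction k using Fin.lastCases with
    | last => exact hx.free j hk hj ▸ hy j
    | cast i => exact hx.block i j hk ▸ hS.div_mem (hy j) (sum_mem fun k _ => hy k)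
  by_cases hj : j ∈ d.E
  · obtain ⟨l, hl, hlj, hlE⟩ := d.exists_relation hj
    rw [hx.isMirrorPoint.eq_prod_compl_zpow hj hl hlj hlE]
    exact prod_mem fun k hk => hS.zpow_mem (hfree (Finset.mem_compl.1 hk)) _
  · exact hfree hj

end Substitution

end PrzyjalkowskiChoice

/-! ### The volume form -/

namespace PrzyjalkowskiChoice

variable {n R c : ℕ} {Y : SmoothCompleteFan n R} {L : Fin c → Y.Pic} {P : NefPartition Y L}
  (d : PrzyjalkowskiChoice P) {K : Type*} [Field K]

/-- The vectors `v_j - v_{s_i}` for `j ∈ S_i`, `i ≤ c`, and `v_j` for `j ∈ S_{c+1}`: the exponents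
of the coordinates `PrzyjalkowskiChoice.quot`. -/
noncomputable def quotRay (K : Type*) [Field K] (j : Fin R) : Fin n → K :=
  Y.rayOver K j - Fin.snoc (α := fun _ => Fin n → K) (fun i => Y.rayOver K (d.s i)) 0
    (P.blockIndex j)

theorem quotRay_of_blockIndex_eq_castSucc {i : Fin c} {j : Fin R}
    (hj : P.blockIndex j = i.castSucc) :
    d.quotRay K j = Y.rayOver K j - Y.rayOver K (d.s i) := by
  rw [quotRay, hj, Fin.snoc_castSucc]

theorem map_quotRay [Algebra ℂ K] {x : Fin R → K} (hx : ∀ j, x j ≠ 0)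
    {π : (Fin n → K) →ₗ[K] Ω[K⁄ℂ]} (hπ : ∀ j, π (Y.rayOver K j) = dlog (x j)) (j : Fin R) :
    π (d.quotRay K j) = dlog (d.quot x j) := by
  rw [quot, dlog_div (hx j) (d.scale_ne_zero hx _), quotRay, map_sub, hπ]
  congr 1
  induction P.blockIndex j using Fin.lastCases with
  | last => rw [Fin.snoc_last, d.scale_last, map_zero, dlog_one]
  | cast i => rw [Fin.snoc_castSucc, d.scale_castSucc, hπ]

theorem quotRay_eq_rayOver_add_sum {ι : Type*} (e : ι ≃ d.Var) (k : ι) :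
    d.quotRay K (e k) = Y.rayOver K (e k) +
      ∑ i, (if P.blockIndex (e k) = i.castSucc then (-1 : K) else 0) • Y.rayOver K (d.s i) := by
  rw [quotRay, sub_eq_add_neg]
  congr 1
  induction P.blockIndex (e k) using Fin.lastCases with
  | last =>
    rw [Fin.snoc_last, neg_zero, Finset.sum_eq_zero fun i _ => ?_]
    rw [if_neg (Fin.castSucc_lt_last i).ne', zero_smul]
  | cast i =>
    simp only [Fin.snoc_castSucc, Fin.castSucc_inj, ite_smul, neg_smul, one_smul, zero_smul,
      Finset.sum_ite_eq, Finset.mem_univ, if_true]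

/-- The vector is the differential of `∑_{j ∈ S_i} x_j`; since this sum is `1`, replacing every
`v_j` by `v_j - v_{s_i}` changes the vector by `v_{s_i}`. -/
theorem sum_smul_rayOver {ι : Type*} [Fintype ι] (e : ι ≃ d.Var) {x : Fin R → K} {i : Fin c}
    (hx : ∑ j ∈ P.S i.castSucc, x j = 1) :
    ∑ j ∈ P.S i.castSucc, x j • Y.rayOver K j = Y.rayOver K (d.s i) +
      ∑ k, (if (e k : Fin R) ∈ P.S i.castSucc then x (e k) else 0) • d.quotRay K (e k) := by
  have hsum : ∑ k, (if (e k : Fin R) ∈ P.S i.castSucc then x (e k) else 0) • d.quotRay K (e k) =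
      ∑ j, (if j ∈ P.S i.castSucc then x j else 0) • d.quotRay K j := by
    refine Fintype.sum_of_injective (fun k => (e k : Fin R))
      (Subtype.val_injective.comp e.injective) _ _ (fun j hj => ?_) fun _ => rfl
    split_ifs with hji
    · have hjs : ¬∀ i, j ≠ d.s i := fun h =>
        hj ⟨e.symm ⟨j, d.notMem_E_of_mem hji, h⟩, congrArg Subtype.val (e.apply_symm_apply _)⟩
      obtain ⟨i', rfl⟩ := not_forall_not.1 hjs
      rw [d.quotRay_of_blockIndex_eq_castSucc (d.blockIndex_s i'), sub_self, smul_zero]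
    · rw [zero_smul]
  simp only [ite_smul, zero_smul, Finset.sum_ite_mem, Finset.univ_inter] at hsum
  simp only [ite_smul, zero_smul, hsum]
  rw [← one_smul K (Y.rayOver K (d.s i)), ← hx, Finset.sum_smul, ← Finset.sum_add_distrib]
  refine Finset.sum_congr rfl fun j hj => ?_
  rw [d.quotRay_of_blockIndex_eq_castSucc ((P.mem_S_iff _ _).1 hj), smul_sub, add_sub_cancel]

theorem det_quotRay_sq {ι : Type*} [Fintype ι] [DecidableEq ι] (e : ι ≃ d.Var)
    (τ : Fin n ≃ ι ⊕ Fin c) {x : Fin R → K}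
    (hx : ∀ i : Fin c, ∑ j ∈ P.S i.castSucc, x j = 1) :
    ((Pi.basisFun K (Fin n)).reindex τ).det (Sum.elim (fun k => d.quotRay K (e k))
      fun i : Fin c => ∑ j ∈ P.S i.castSucc, x j • Y.rayOver K j) ^ 2 = 1 := by
  rw [← d.det_rayOver_sq K e τ]
  simp only [fun i => d.sum_smul_rayOver e (hx i)]
  rw [alternatingMap_sumElim_add_right _ (fun k => d.quotRay K (e k)) (fun i => Y.rayOver K (d.s i))
    fun i k => if (e k : Fin R) ∈ P.S i.castSucc then x (e k) else 0]
  simp only [d.quotRay_eq_rayOver_add_sum e]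
  rw [alternatingMap_sumElim_add_left _ (fun k => Y.rayOver K (e k)) (fun i => Y.rayOver K (d.s i))
    fun k i => if P.blockIndex (e k) = i.castSucc then (-1 : K) else 0]

end PrzyjalkowskiChoice

namespace IsFlowExchange

variable {ι V W K : Type*} [Fintype ι] [DecidableEq V] [Field K] [Algebra ℂ K] [AddCommGroup W]
  [Module K W] {b b' : ι → V} {ν : Finset V} {x x' : ι → K} {h : V → K}

/-- Both sides solve the linearized flow equation, which has a unique solution. -/
theorem map_eq_dlog (H : IsFlowExchange b b' ν x x' h)
    (hL : IsUnit (laplacian b b' ν fun j => x j * h (b j))) (hx : ∀ j, x j ≠ 0) {v : ι → W}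
    {π : W →ₗ[K] Ω[K⁄ℂ]} (hπ : ∀ j, π (v j) = dlog (x j)) {η : V → W} (hη : ∀ k ∉ ν, η k = 0)
    (hdiv : ∀ k, divergence b b' (fun j => (x j * h (b j)) • (v j + η (b j))) k = 0) (k : V) :
    π (η k) = dlog (h k) := by
  refine sub_eq_zero.1 (eq_zero_of_divergence_eq_zero (η := fun k => π (η k) - dlog (h k)) hL
    (fun k hk => ?_) (fun k _ => ?_) k)
  · rw [hη k hk, H.potential_eq_one k hk, map_zero, dlog_one, sub_zero]
  · have hD : divergence b b' (fun j => KaehlerDifferential.D ℂ K (x j * h (b j))) k = 0 := by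
      rw [← map_divergence, H.divergence_eq_zero, map_zero]
    have hsplit (j : ι) : π ((x j * h (b j)) • (v j + η (b j))) =
        (x j * h (b j)) • (π (η (b j)) - dlog (h (b j))) +
          KaehlerDifferential.D ℂ K (x j * h (b j)) := by
      rw [← smul_dlog (H.flow_ne_zero (hx j)), dlog_mul (hx j) (H.potential_ne_zero _), map_smul,
        map_add, hπ, ← smul_add]
      congr 1
      abel
    have hzero := congrArg π (hdiv k)
    simpa only [map_divergence, hsplit, divergence_add, hD, add_zero, map_zero] using hzero

theorem exists_linearMap_dlog [Finite V] [FiniteDimensional K W]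
    (H : IsFlowExchange b b' ν x x' h) (hν : IsReducing b b' ν)
    (hL : IsUnit (laplacian b b' ν fun j => x j * h (b j))) (hx : ∀ j, x j ≠ 0) {v : ι → W}
    {π : W →ₗ[K] Ω[K⁄ℂ]} (hπ : ∀ j, π (v j) = dlog (x j)) {m : V → Module.Dual K W}
    (hm : ∀ k j, m k (v j) = (if b j = k then 1 else 0) - if b' j = k then 1 else 0) :
    ∃ Φ : W →ₗ[K] W, LinearMap.det Φ = (-1) ^ ν.card ∧ (∀ j, π (Φ (v j)) = dlog (x' j)) ∧
      ∀ k, Φ (∑ j with b' j = k, x' j • v j) = ∑ j with b j = k, x j • v j := by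
  obtain ⟨η, hη, hdiv⟩ := hν.exists_divergence_smul_eq_zero hL v
  have hlog := H.map_eq_dlog hL hx hπ hη hdiv
  have hΦ := id_add_sum_smulRight_apply hη hm
  refine ⟨LinearMap.id + ∑ i : ν, (m i).smulRight (η i), ?_, fun j => ?_, fun k => ?_⟩
  · rw [det_id_add_sum_smulRight]
    exact det_one_add_of_divergence_eq_zero H.divergence_eq_zero hL hη (fun k _ => hdiv k) hm
  · rw [hΦ, map_sub, map_add, hπ, hlog, hlog, H.eq_mul_div,
      dlog_mul (hx j) (div_ne_zero (H.potential_ne_zero _) (H.potential_ne_zero _)),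
      dlog_div (H.potential_ne_zero _) (H.potential_ne_zero _), add_sub_assoc]
  · rw [map_sum]
    simp only [map_smul, hΦ]
    exact H.sum_smul_add_sub (hdiv k)

end IsFlowExchange

section MirrorPoints

variable {n R c : ℕ} {Y : SmoothCompleteFan n R} {L : Fin c → Y.Pic} {P P' : NefPartition Y L}
  {K : Type*} [Field K] [Algebra ℂ K] {x x' : Fin R → K}

theorem NefPartition.IsMirrorPoint.map_sum_smul_rayOver (hx : P.IsMirrorPoint x)
    {π : (Fin n → K) →ₗ[K] Ω[K⁄ℂ]} (hπ : ∀ j, π (Y.rayOver K j) = dlog (x j)) (i : Fin c) :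
    π (∑ j ∈ P.S i.castSucc, x j • Y.rayOver K j) = 0 := by
  simp only [map_sum, map_smul, hπ, smul_dlog (hx.ne_zero _)]
  rw [← map_sum, hx.sum_eq_one, Derivation.map_one_eq_zero]

namespace PrzyjalkowskiChoice

/-- The forms are the images of `∧ (v_j - v_{s_i})` and of its transform by a linear map of
determinant `±1`; the vectors killed by the projection to `Ω` complete both to volume forms. -/
theorem map_dlog_quot_eq_or_eq_neg (d : PrzyjalkowskiChoice P) (d' : PrzyjalkowskiChoice P')
    {ν : Finset (Fin (c + 1))} {h : Fin (c + 1) → K} (hx : P.IsMirrorPoint x)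
    (H : IsFlowExchange P.blockIndex P'.blockIndex ν x x' h)
    (hν : IsReducing P.blockIndex P'.blockIndex ν)
    (hL : IsUnit (laplacian P.blockIndex P'.blockIndex ν fun j => x j * h (P.blockIndex j)))
    {ι U : Type*} [Finite ι] [AddCommGroup U] [Module K U]
    (e : ι ≃ d.Var) (e' : ι ≃ d'.Var) (f : Ω[K⁄ℂ] [⋀^ι]→ₗ[K] U) :
    f (fun k => dlog (d'.quot x' (e' k))) = f (fun k => dlog (d.quot x (e k))) ∨
      f (fun k => dlog (d'.quot x' (e' k))) = -f (fun k => dlog (d.quot x (e k))) := by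
  classical
  cases nonempty_fintype ι
  obtain ⟨π, hπ⟩ := hx.exists_dlog
  choose m hm using P.exists_dual_rayOver P' K
  obtain ⟨Φ, hdet, hπΦ, hΦ⟩ := H.exists_linearMap_dlog hν hL hx.ne_zero hπ hm
  have hx' := hx.of_isFlowExchange H
  have hcard : n = Fintype.card ι + c := by
    rw [← d.card_var_add, ← Nat.card_congr e, Nat.card_eq_fintype_card]
  let τ : Fin n ≃ ι ⊕ Fin c := Fintype.equivOfCardEq (by simp [hcard])
  let B := (Pi.basisFun K (Fin n)).reindex τ
  let κ (i : Fin c) : Fin n → K := ∑ j ∈ P.S i.castSucc, x j • Y.rayOver K j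
  let κ' (i : Fin c) : Fin n → K := ∑ j ∈ P'.S i.castSucc, x' j • Y.rayOver K j
  have hu : B.det (Sum.elim (fun k => d.quotRay K (e k)) κ) ^ 2 = 1 :=
    d.det_quotRay_sq e τ hx.sum_eq_one
  have hw : B.det (Sum.elim (fun k => Φ (d'.quotRay K (e' k))) κ) ^ 2 = 1 := by
    have hcomp : Sum.elim (fun k => Φ (d'.quotRay K (e' k))) κ =
        Φ ∘ Sum.elim (fun k => d'.quotRay K (e' k)) κ' := by
      rw [Sum.comp_elim]
      refine congrArg _ (funext fun i => ?_)
      simp only [κ, κ', Function.comp_apply, NefPartition.S_eq_filter, hΦ]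
    rw [hcomp, Module.Basis.det_comp, hdet, mul_pow, d'.det_quotRay_sq e' τ hx'.sum_eq_one,
      mul_one, pow_right_comm, neg_one_sq, one_pow]
  have hu0 : B.det (Sum.elim (fun k => d.quotRay K (e k)) κ) ≠ 0 :=
    fun h0 => zero_ne_one ((zero_pow two_ne_zero).symm.trans (h0 ▸ hu))
  have hforms := det_smul_map_of_map_eq_zero B f π (fun k => Φ (d'.quotRay K (e' k)))
    (hx.map_sum_smul_rayOver hπ) hu0.isUnit
  simp only [d.map_quotRay hx.ne_zero hπ,
    fun j => d'.map_quotRay (π := π ∘ₗ Φ) hx'.ne_zero hπΦ j, ← LinearMap.comp_apply] at hforms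
  refine (sq_eq_sq_iff_eq_or_eq_neg.1 (hw.trans hu.symm)).imp (fun h => ?_) fun h => ?_ <;>
    refine smul_right_injective U hu0 (hforms.trans ?_)
  · rw [h]
  · exact (congrArg (· • _) h).trans ((neg_smul _ _).trans (smul_neg _ _).symm)

end PrzyjalkowskiChoice

end MirrorPoints

/-! ### The birational map -/

namespace PrzyjalkowskiChoice

variable {n R c : ℕ} {Y : SmoothCompleteFan n R} {L : Fin c → Y.Pic} {P P' : NefPartition Y L}
  {d : PrzyjalkowskiChoice P} {x : Fin R → TorusFunctionField d.Var}

theorem IsSubstitution.eq_top_of_mem (hx : d.IsSubstitution x)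
    {F : IntermediateField ℂ (TorusFunctionField d.Var)} (hF : ∀ j, x j ∈ F) : F = ⊤ := by
  refine TorusFunctionField.eq_top_of_torusCoord_mem fun j => ?_
  rw [← hx.quot_eq_torusCoord, quot]
  induction P.blockIndex j using Fin.lastCases with
  | last => rw [scale_last, div_one]; exact hF j
  | cast i => rw [scale_castSucc]; exact div_mem (hF j) (hF _)

theorem IsSubstitution.adjoin_range_quot (hx : d.IsSubstitution x) (d' : PrzyjalkowskiChoice P')
    {x' : Fin R → TorusFunctionField d.Var} {ν : Finset (Fin (c + 1))}
    {h : Fin (c + 1) → TorusFunctionField d.Var}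
    (H : IsFlowExchange P.blockIndex P'.blockIndex ν x x' h)
    (hL : IsUnit (laplacian P'.blockIndex P.blockIndex ν x')) :
    IntermediateField.adjoin ℂ (Set.range fun j : d'.Var => d'.quot x' j) = ⊤ := by
  set F := IntermediateField.adjoin ℂ (Set.range fun j : d'.Var => d'.quot x' j)
  have hx' (j : Fin R) : x' j ∈ F.toSubfield :=
    d'.mem_of_quot_mem (hx.isMirrorPoint.of_isFlowExchange H)
      (fun j => IntermediateField.subset_adjoin ℂ _ (Set.mem_range_self j)) j
  have hh := H.symm.potential_mem hL hx'
  refine hx.eq_top_of_mem fun j => ?_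
  rw [H.symm.eq_mul_div]
  exact F.mul_mem (hx' j) (F.div_mem (hh _) (hh _))

theorem nonempty_var_equiv (d : PrzyjalkowskiChoice P) (d' : PrzyjalkowskiChoice P') :
    Nonempty (d.Var ≃ d'.Var) :=
  Finite.card_eq.1 (Nat.add_right_cancel (d.card_var_add.trans d'.card_var_add.symm))

theorem IsSubstitution.isVolumePreserving (hx : d.IsSubstitution x) (d' : PrzyjalkowskiChoice P')
    {x' : Fin R → TorusFunctionField d.Var} {ν : Finset (Fin (c + 1))}
    {h : Fin (c + 1) → TorusFunctionField d.Var}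
    (H : IsFlowExchange P.blockIndex P'.blockIndex ν x x' h)
    (hν : IsReducing P.blockIndex P'.blockIndex ν)
    (hL : IsUnit (laplacian P.blockIndex P'.blockIndex ν fun j => x j * h (P.blockIndex j)))
    {ψ : TorusFunctionField d'.Var ≃ₐ[ℂ] TorusFunctionField d.Var}
    (hψ : ∀ j : d'.Var, ψ (torusCoord j) = d'.quot x' j) : IsVolumePreserving ψ := by
  obtain ⟨ε⟩ := d.nonempty_var_equiv d'
  let e := (Finite.equivFin d.Var).symm
  refine ⟨_, e.trans ε, e, ?_⟩
  simp only [hψ, ← hx.quot_eq_torusCoord]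
  exact d.map_dlog_quot_eq_or_eq_neg d' hx.isMirrorPoint H hν hL e (e.trans ε)
    (exteriorPower.ιMulti _ _)

theorem IsSubstitution.exists_algEquiv (hx : d.IsSubstitution x) {d' : PrzyjalkowskiChoice P'}
    {z : Fin R → TorusFunctionField d'.Var} (hz : d'.IsSubstitution z) :
    ∃ ψ : TorusFunctionField d'.Var ≃ₐ[ℂ] TorusFunctionField d.Var,
      IsVolumePreserving ψ ∧ ψ (∑ j, z j) = ∑ j, x j := by
  have hS := TorusFunctionField.isPositiveCone_positiveCone (J := d.Var)
  have hb := P.isBalanced_blockIndex P'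
  obtain ⟨ν, hν⟩ := exists_isReducing P.blockIndex P'.blockIndex
  obtain ⟨x', h, H, hh⟩ := hν.exists_isFlowExchange hb hS hx.mem_positiveCone hx.ne_zero
  have hx' := hx.isMirrorPoint.of_isFlowExchange H
  have hxS' (j : Fin R) : x' j ∈ TorusFunctionField.positiveCone d.Var :=
    H.eq_mul_div j ▸ mul_mem (hx.mem_positiveCone j) (hS.div_mem (hh _) (hh _))
  have hflow := hν.isUnit_laplacian hb hS (fun j => mul_mem (hx.mem_positiveCone j) (hh _))
    fun j => H.flow_ne_zero (hx.ne_zero j)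
  obtain ⟨ε⟩ := d'.nonempty_var_equiv d
  obtain ⟨ψ, hψ⟩ := TorusFunctionField.exists_algEquiv ε
    (hx.adjoin_range_quot d' H (hν.symm.isUnit_laplacian hb.symm hS hxS' hx'.ne_zero))
  refine ⟨ψ, hx.isVolumePreserving d' H hν hflow hψ, ?_⟩
  calc ψ (∑ j, z j) = ∑ j, x' j := by
        rw [map_sum]
        exact Finset.sum_congr rfl fun j _ => d'.map_eq_of_map_quot_eq hz.isMirrorPoint hx' ψ
          (fun k => (congrArg ψ (hz.quot_eq_torusCoord k)).trans (hψ k)) j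
    _ = ∑ k, ∑ j with P'.blockIndex j = k, x' j := (Finset.sum_fiberwise _ _ _).symm
    _ = ∑ k, ∑ j with P.blockIndex j = k, x j := Finset.sum_congr rfl fun k _ => H.sum_eq k
    _ = ∑ j, x j := Finset.sum_fiberwise _ _ _

end PrzyjalkowskiChoice

theorem corollary2_general {n R c : ℕ} {Y : SmoothCompleteFan n R} {L : Fin c → Y.Pic}
    {P P' : NefPartition Y L} {d : PrzyjalkowskiChoice P} {d' : PrzyjalkowskiChoice P'}
    {f : LaurentRing d.Var} {g : LaurentRing d'.Var} (hf : d.IsMirror f) (hg : d'.IsMirror g) :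
    MutationEquivalent f g := by
  obtain ⟨x, hx, hfx⟩ := hf
  obtain ⟨x', hx', hgx⟩ := hg
  obtain ⟨ψ, hvol, hψ⟩ := hx'.exists_algEquiv hx
  exact ⟨ψ, hvol, by rw [hfx, hgx, hψ]⟩

theorem corollary2 {n R c : ℕ} (Y : SmoothCompleteFan n R) (hY : Y.IsAmple Y.antiK)
    (L : Fin c → Y.Pic) (hL : ∀ i, Y.IsNef (L i)) (hΛ : Y.IsAmple (Y.antiK - ∑ i, L i))
    (P P' : NefPartition Y L) (d : PrzyjalkowskiChoice P) (d' : PrzyjalkowskiChoice P')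
    (f : LaurentRing d.Var) (g : LaurentRing d'.Var) (hf : d.IsMirror f) (hg : d'.IsMirror g) :
    MutationEquivalent f g :=
  corollary2_general hf hg
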